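/- Let $N\ge 1$ and $n\ge 1$ be integers. For $k=1,\dots,n$ let $W_k=(w^{(k)}_{ij})\in\mathbb R^{N\times N}$ be the entrywise nonnegative weighted adjacency matrix of a graph on $\{1,\dots,N\}$ (with an edge from $j$ to $i$ if and only if $w^{(k)}_{ij}>0$), and let $L_k$ be its graph Laplacian, $[L_k]_{ij}=-w^{(k)}_{ij}$ for $i\ne j$ and $[L_k]_{ii}=\sum_{l\ne i}w^{(k)}_{il}$. Assume that $L_k=L_k^{T}$ and that each graph contains a connected spanning tree, i.e. it has a vertex from which there is a path to every other vertex. Let $\mathcal{RH}_\infty$ denote the set of proper real rational transfer matrices all of whose poles have negative real part, and for square $G\in\mathcal{RH}_\infty$ let $\|G\|_{\mathcal H_\infty}=\sup_{\operatorname{Re}s>0}\bar\sigma(G(s))$, where $\bar\sigma$ is the largest singular value. Let $\Delta_0,\Delta_1,\dots,\Delta_n\in\mathcal{RH}_\infty$ be of size $N\times N$, let $U_{\mathrm{ref}}\in\mathcal{RH}_\infty$ be of size $N\times 1$, and consider the perturbed $n$-th order serial consensus system $$\bigl(sI+s\Delta_0(s)+(I+\Delta_n(s))L_n\bigr)\prod_{k=1}^{n-1}\bigl(sI+(I+\Delta_k(s))L_k\bigr)\,X(s)=U_{\mathrm{ref}}(s),$$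 where the factors of the product are written from left to right in the order $k=1,\dots,n-1$. A trajectory of this system is a function $x=(x_1,\dots,x_N)$ with values in $\mathbb R^N$ that is $n$ times continuously differentiable on $(0,\infty)$ and whose Laplace transform $X(s)=\int_0^\infty e^{-st}x(t)\,dt$ converges absolutely and satisfies the equation for all $s$ in some right half-plane. If $$\|\Delta_k\|_{\mathcal H_\infty}<1\quad\text{for all }k\in\{0,1,\dots,n\}\qquad\text{and}\qquad \|\Delta_0\|_{\mathcal H_\infty}+\|\Delta_n\|_{\mathcal H_\infty}<1,$$ then the system has a trajectory, and it achieves $n$-th order consensus: every trajectory $x$ satisfies $$\lim_{t\to\infty}\bigl|x_i^{(k)}(t)-x_j^{(k)}(t)\bigr|=0\qquad\text{for all }i,j\in\{1,\dots,N\}\text{ and }k\in\{0,1,\dots,n-1\}.$$ -/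

import Mathlib

open scoped ENNReal

noncomputable section

namespace SerialConsensus

/-- The weighted graph Laplacian of the adjacency matrix `W` (self-loops do not contribute). -/
def laplacian {N : ℕ} (W : Matrix (Fin N) (Fin N) ℝ) : Matrix (Fin N) (Fin N) ℝ :=
  Matrix.of fun i j => if i = j then ∑ k ∈ Finset.univ.erase i, W i k else -W i j

/-- The weighted directed graph of `W`, which has an edge from `j` to `i` iff `0 < W i j`,
contains a connected spanning tree: from some vertex there is a path to every vertex. -/
def HasConnectedSpanningTree {N : ℕ} (W : Matrix (Fin N) (Fin N) ℝ) : Prop :=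
  ∃ r, ∀ v, Relation.ReflTransGen (fun j i => 0 < W i j) r v

/-- The value at `s : ℂ` of a real rational function. -/
def evalAt (f : RatFunc ℝ) (s : ℂ) : ℂ := f.eval (algebraMap ℝ ℂ) s

/-- The real rational function `f` is proper and stable: in lowest terms, the degree of the
numerator is at most that of the denominator, and every pole has negative real part. -/
def IsProperStable (f : RatFunc ℝ) : Prop :=
  f.num.natDegree ≤ f.denom.natDegree ∧
    ∀ s : ℂ, Polynomial.aeval s f.denom = 0 → s.re < 0

/-- `G` belongs to `RH∞`: it is a proper, real rational and stable transfer matrix. -/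
def IsRHInf {m n : Type*} (G : Matrix m n (RatFunc ℝ)) : Prop :=
  ∀ i j, IsProperStable (G i j)

/-- The value `G(s)` of a transfer matrix. -/
def evalMatrix {m n : Type*} (G : Matrix m n (RatFunc ℝ)) (s : ℂ) : Matrix m n ℂ :=
  G.map fun f => evalAt f s

/-- The `H∞` norm of a square transfer matrix: the supremum over the open right half-plane of
the largest singular value (the operator norm for the Euclidean norm) of `G(s)`. -/
def hInfNorm {N : ℕ} (G : Matrix (Fin N) (Fin N) (RatFunc ℝ)) : ℝ≥0∞ :=
  ⨆ (s : ℂ) (_ : 0 < s.re), ‖Matrix.toEuclideanCLM (n := Fin N) (𝕜 := ℂ) (evalMatrix G s)‖ₑ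

/-- The value at `s` of the factor `sI + (I + Δ) L`. -/
def innerFactor {N : ℕ} (L : Matrix (Fin N) (Fin N) ℝ)
    (Δ : Matrix (Fin N) (Fin N) (RatFunc ℝ)) (s : ℂ) : Matrix (Fin N) (Fin N) ℂ :=
  s • 1 + (1 + evalMatrix Δ s) * L.map Complex.ofReal

/-- The value at `s` of the factor `sI + s Δ₀ + (I + Δ) L`. -/
def outerFactor {N : ℕ} (L : Matrix (Fin N) (Fin N) ℝ)
    (Δ₀ Δ : Matrix (Fin N) (Fin N) (RatFunc ℝ)) (s : ℂ) : Matrix (Fin N) (Fin N) ℂ :=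
  s • 1 + s • evalMatrix Δ₀ s + (1 + evalMatrix Δ s) * L.map Complex.ofReal

/-- The value at `s` of
`(sI + s Δ₀ + (I + Δₙ) Lₙ) * (sI + (I + Δ₁) L₁) * ⋯ * (sI + (I + Δₙ₋₁) Lₙ₋₁)`.
Only `L k` with `1 ≤ k ≤ n` and `Δ k` with `0 ≤ k ≤ n` occur, for `1 ≤ n`. -/
def perturbedSystem {N : ℕ} (n : ℕ) (L : ℕ → Matrix (Fin N) (Fin N) ℝ)
    (Δ : ℕ → Matrix (Fin N) (Fin N) (RatFunc ℝ)) (s : ℂ) : Matrix (Fin N) (Fin N) ℂ :=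
  outerFactor (L n) (Δ 0) (Δ n) s *
    ((List.range' 1 (n - 1)).map fun k => innerFactor (L k) (Δ k) s).prod

/-- The one-sided Laplace transform `∫₀^∞ e^{-st} f(t) dt`. -/
def laplaceTransform (f : ℝ → ℝ) (s : ℂ) : ℂ :=
  ∫ t in Set.Ioi (0 : ℝ), Complex.exp (-s * t) * (f t : ℂ)

/-- `x` is the time-domain solution, on `t > 0`, of `T(s) X(s) = U(s)`: it is `n` times
continuously differentiable there, and on some right half-plane its Laplace transform `X(s)`
converges absolutely and satisfies the equation. -/
structure IsTrajectory {N : ℕ} (n : ℕ) (T : ℂ → Matrix (Fin N) (Fin N) ℂ)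
    (U : Fin N → RatFunc ℝ) (x : ℝ → Fin N → ℝ) : Prop where
  contDiffOn : ∀ i, ContDiffOn ℝ n (fun t => x t i) (Set.Ioi 0)
  laplace : ∃ σ : ℝ, ∀ s : ℂ, σ < s.re →
    (∀ i, MeasureTheory.IntegrableOn
      (fun t : ℝ => Complex.exp (-s * t) * (x t i : ℂ)) (Set.Ioi 0)) ∧
    (T s).mulVec (fun i => laplaceTransform (fun t => x t i) s) = fun i => evalAt (U i) s

/-- `n`-th order consensus: all differences of the `k`-th derivatives, `0 ≤ k ≤ n - 1`, of the
agents' positions tend to zero. -/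
def AchievesConsensus {N : ℕ} (n : ℕ) (x : ℝ → Fin N → ℝ) : Prop :=
  ∀ i j, ∀ k < n, Filter.Tendsto
    (fun t => |iteratedDeriv k (fun τ => x τ i) t - iteratedDeriv k (fun τ => x τ j) t|)
    Filter.atTop (nhds 0)

end SerialConsensus

end

namespace SerialConsensus

open Filter Topology Polynomial MeasureTheory

/-! A Laplacian L with symmetric nonnegative weights is positive semidefinite, so for Re s ≥ 0 the
cross term in ‖sv + Lv‖² is nonnegative and the square dominates ‖sv‖² + ‖Lv‖². An error of size at
most a‖sv‖ + b‖Lv‖ with a + b < 1 then costs only a constant factor (`lower_bound`), so each factor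
of the system controls both sv and Lv, uniformly on Re s > 0.

Connectedness bounds L below on the disagreement space, the orthogonal complement of the constant
vectors, with projection P. Chaining the estimates for the factors gives |s|^n ‖v‖ ≤ C‖T(s)v‖ and
‖Pv‖ ≤ C‖T(s)v‖ for the whole product T (`perturbedSystem_bound`). The first makes T(s) invertible
and X = T⁻¹U rational and strictly proper. The second, as U is stable, bounds X_i - X_j near every
point of the closed right half-plane, even near s = 0, where X itself may have a pole. Hence all
poles of the differences lie in the open left half-plane.

By partial fractions such a difference is the transform of the real part of an exponential
polynomial that decays with all its derivatives (`IsRationalFn.exists_hasLaplace_decay`).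
Injectivity of the Laplace transform (`HasLaplace.eq_zero`) identifies that function with x_i - x_j
for every trajectory x. -/

/-! ### Rational functions up to finitely many points -/

/-- `F` agrees, off a finite set, with a quotient of real polynomials. -/
def IsRationalFn (F : ℂ → ℂ) : Prop :=
  ∃ p q : ℝ[X], q ≠ 0 ∧ ∀ᶠ s in cofinite, F s = aeval s p / aeval s q

lemma eventually_cofinite_aeval_ne_zero {q : ℝ[X]} (hq : q ≠ 0) :
    ∀ᶠ s : ℂ in cofinite, aeval s q ≠ 0 := by
  have h : q.map (algebraMap ℝ ℂ) ≠ 0 := by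
    rwa [Ne, Polynomial.map_eq_zero_iff (algebraMap ℝ ℂ).injective]
  refine ((q.map (algebraMap ℝ ℂ)).roots.toFinset.finite_toSet).subset ?_
  intro s hs
  have hs' : aeval s q = 0 := by simpa using hs
  simp [h, IsRoot, eval_map_algebraMap, hs']

namespace IsRationalFn

variable {F G : ℂ → ℂ}

lemma congr' (hF : IsRationalFn F) (h : ∀ᶠ s in cofinite, G s = F s) : IsRationalFn G := by
  obtain ⟨p, q, hq, hpq⟩ := hF
  exact ⟨p, q, hq, by filter_upwards [hpq, h] with s h₁ h₂ using h₂.trans h₁⟩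

lemma ofReal (c : ℝ) : IsRationalFn fun _ => (c : ℂ) :=
  ⟨C c, 1, one_ne_zero, by simp⟩

lemma zero : IsRationalFn fun _ => (0 : ℂ) := by simpa using ofReal 0

lemma one : IsRationalFn fun _ => (1 : ℂ) := by simpa using ofReal 1

lemma id : IsRationalFn fun s => s := ⟨X, 1, one_ne_zero, by simp⟩

lemma evalAt (f : RatFunc ℝ) : IsRationalFn (evalAt f) :=
  ⟨f.num, f.denom, f.denom_ne_zero, Eventually.of_forall fun _ => rfl⟩

lemma add (hF : IsRationalFn F) (hG : IsRationalFn G) : IsRationalFn fun s => F s + G s := by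
  obtain ⟨p, q, hq, h⟩ := hF
  obtain ⟨p', q', hq', h'⟩ := hG
  refine ⟨p * q' + q * p', q * q', mul_ne_zero hq hq', ?_⟩
  filter_upwards [h, h', eventually_cofinite_aeval_ne_zero hq,
    eventually_cofinite_aeval_ne_zero hq'] with s h₁ h₂ h₃ h₄
  rw [h₁, h₂, div_add_div _ _ h₃ h₄]
  simp

lemma mul (hF : IsRationalFn F) (hG : IsRationalFn G) : IsRationalFn fun s => F s * G s := by
  obtain ⟨p, q, hq, h⟩ := hF
  obtain ⟨p', q', hq', h'⟩ := hG
  refine ⟨p * p', q * q', mul_ne_zero hq hq', ?_⟩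
  filter_upwards [h, h'] with s h₁ h₂
  rw [h₁, h₂, div_mul_div_comm, map_mul, map_mul]

lemma inv (hF : IsRationalFn F) : IsRationalFn fun s => (F s)⁻¹ := by
  obtain ⟨p, q, hq, h⟩ := hF
  -- Swapping numerator and denominator fails only for p = 0; then F vanishes off a finite set, and
  -- so does its inverse, by the convention 0⁻¹ = 0.
  by_cases hp : p = 0
  · refine zero.congr' ?_
    filter_upwards [h] with s h₁
    simp [h₁, hp]
  · refine ⟨q, p, hp, ?_⟩
    filter_upwards [h] with s h₁
    rw [h₁, inv_div]

lemma sub (hF : IsRationalFn F) (hG : IsRationalFn G) : IsRationalFn fun s => F s - G s := by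
  simpa [sub_eq_add_neg] using hF.add ((ofReal (-1)).mul hG)

lemma sum {ι : Type*} (t : Finset ι) {F : ι → ℂ → ℂ} (h : ∀ i ∈ t, IsRationalFn (F i)) :
    IsRationalFn fun s => ∑ i ∈ t, F i s := by
  classical
  induction t using Finset.induction_on with
  | empty => simpa using zero
  | insert a t ha ih =>
    simp only [Finset.sum_insert ha]
    exact (h a (by simp)).add (ih fun i hi => h i (by simp [hi]))

lemma prod {ι : Type*} (t : Finset ι) {F : ι → ℂ → ℂ} (h : ∀ i ∈ t, IsRationalFn (F i)) :
    IsRationalFn fun s => ∏ i ∈ t, F i s := by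
  classical
  induction t using Finset.induction_on with
  | empty => simpa using one
  | insert a t ha ih =>
    simp only [Finset.prod_insert ha]
    exact (h a (by simp)).mul (ih fun i hi => h i (by simp [hi]))

lemma det {m : Type*} [Fintype m] [DecidableEq m] {A : ℂ → Matrix m m ℂ}
    (h : ∀ i j, IsRationalFn fun s => A s i j) : IsRationalFn fun s => (A s).det := by
  simp only [Matrix.det_apply']
  refine sum _ fun σ _ => IsRationalFn.mul ?_ (prod _ fun i _ => h _ _)
  simpa using ofReal ((σ.sign : ℤ) : ℝ)

lemma matrix_mul {m : Type*} [Fintype m] {A B : ℂ → Matrix m m ℂ}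
    (hA : ∀ i j, IsRationalFn fun s => A s i j) (hB : ∀ i j, IsRationalFn fun s => B s i j)
    (i j : m) : IsRationalFn fun s => (A s * B s) i j := by
  simp only [Matrix.mul_apply]
  exact sum _ fun k _ => (hA i k).mul (hB k j)

/-- A rational function has a representation in lowest terms. -/
lemma exists_isCoprime (hF : IsRationalFn F) : ∃ p q : ℝ[X], IsCoprime p q ∧ q ≠ 0 ∧
    ∀ᶠ s in cofinite, F s = aeval s p / aeval s q := by
  obtain ⟨p, q, hq, h⟩ := hF
  obtain ⟨p', hp'⟩ := EuclideanDomain.gcd_dvd_left p q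
  obtain ⟨q', hq'⟩ := EuclideanDomain.gcd_dvd_right p q
  have hg : EuclideanDomain.gcd p q ≠ 0 := fun h0 => hq (by rw [hq', h0, zero_mul])
  have hq'0 : q' ≠ 0 := fun h0 => hq (by rw [hq', h0, mul_zero])
  refine ⟨p', q', ?_, hq'0, ?_⟩
  · obtain ⟨a, b, hab⟩ : ∃ a b, EuclideanDomain.gcd p q = p * a + q * b :=
      ⟨_, _, EuclideanDomain.gcd_eq_gcd_ab p q⟩
    refine ⟨a, b, mul_left_cancel₀ hg ?_⟩
    calc _ = (EuclideanDomain.gcd p q * p') * a + (EuclideanDomain.gcd p q * q') * b := by ring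
      _ = _ := by rw [← hp', ← hq', ← hab, mul_one]
  · filter_upwards [h, eventually_cofinite_aeval_ne_zero hg] with s h₁ h₂
    rw [h₁, ← mul_div_mul_left (aeval s p') _ h₂, ← map_mul, ← map_mul, ← hp', ← hq']

end IsRationalFn

/-! ### Poles and behaviour at infinity -/

/-- Horizontal approach from the right stays in the open right half-plane even when s₀ is on the
imaginary axis, and it eventually avoids any finite exceptional set. -/
lemma tendsto_add_ofReal_nhdsNE (s₀ : ℂ) :
    Tendsto (fun ε : ℝ => s₀ + ε) (𝓝[>] 0) (𝓝[≠] s₀) := by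
  refine tendsto_nhdsWithin_iff.2 ⟨?_, ?_⟩
  · have : Tendsto (fun ε : ℝ => s₀ + ε) (𝓝 0) (𝓝 (s₀ + (0 : ℝ))) :=
      (continuous_const.add Complex.continuous_ofReal).tendsto 0
    simpa using this.mono_left nhdsWithin_le_nhds
  · filter_upwards [self_mem_nhdsWithin] with ε hε
    simpa using (ne_of_gt hε : ε ≠ 0)

/-- A rational function in lowest terms has no pole at a point near which it is bounded. -/
lemma aeval_ne_zero_of_bounded {F : ℂ → ℂ} {p q : ℝ[X]} (hpq : IsCoprime p q)
    (hF : ∀ᶠ s in cofinite, F s = aeval s p / aeval s q) (hq : q ≠ 0) (s₀ : ℂ)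
    (hb : ∃ C : ℝ, ∀ᶠ ε : ℝ in 𝓝[>] 0, ‖F (s₀ + ε)‖ ≤ C) : aeval s₀ q ≠ 0 := by
  intro h0
  obtain ⟨C, hC⟩ := hb
  have ht := tendsto_add_ofReal_nhdsNE s₀
  -- In the limit |p| ≤ C|q| makes p vanish at s₀ along with q, against the Bézout identity.
  have hle : ∀ᶠ ε : ℝ in 𝓝[>] 0, ‖aeval (s₀ + (ε : ℂ)) p‖ ≤ C * ‖aeval (s₀ + (ε : ℂ)) q‖ := by
    have h1 := ht.eventually (hF.filter_mono (nhdsNE_le_cofinite s₀))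
    have h2 := ht.eventually
      ((eventually_cofinite_aeval_ne_zero hq).filter_mono (nhdsNE_le_cofinite s₀))
    filter_upwards [hC, h1, h2] with ε h₁ h₂ h₃
    rw [h₂, norm_div, div_le_iff₀ (norm_pos_iff.2 h₃)] at h₁
    exact h₁
  have htd : Tendsto (fun ε : ℝ => s₀ + (ε : ℂ)) (𝓝[>] 0) (𝓝 s₀) :=
    ht.mono_right nhdsWithin_le_nhds
  have hp : Tendsto (fun ε : ℝ => ‖aeval (s₀ + (ε : ℂ)) p‖) (𝓝[>] 0) (𝓝 ‖aeval s₀ p‖) :=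
    ((Polynomial.continuous_aeval p).tendsto s₀ |>.comp htd).norm
  have hq' : Tendsto (fun ε : ℝ => C * ‖aeval (s₀ + (ε : ℂ)) q‖) (𝓝[>] 0)
      (𝓝 (C * ‖aeval s₀ q‖)) :=
    ((Polynomial.continuous_aeval q).tendsto s₀ |>.comp htd).norm.const_mul C
  have := le_of_tendsto_of_tendsto hp hq' hle
  rw [h0, norm_zero, mul_zero, norm_le_zero_iff] at this
  obtain ⟨a, b, hab⟩ := hpq
  have h1 := congrArg (aeval s₀) hab
  simp [this, h0] at h1

lemma tendsto_ofReal_cofinite : Tendsto (fun r : ℝ => (r : ℂ)) atTop cofinite :=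
  (Complex.ofReal_injective.tendsto_cofinite).mono_left atTop_le_cofinite

/-- A rational function that vanishes at infinity is strictly proper. -/
lemma degree_lt_of_tendsto_zero {F : ℂ → ℂ} {p q : ℝ[X]}
    (hF : ∀ᶠ s in cofinite, F s = aeval s p / aeval s q) (hq : q ≠ 0)
    (h0 : Tendsto (fun r : ℝ => F r) atTop (𝓝 0)) : p.degree < q.degree := by
  rw [← Polynomial.div_tendsto_atTop_zero_iff_degree_lt p q hq]
  have h1 : Tendsto (fun r : ℝ => (F r).re) atTop (𝓝 0) := by
    simpa [Function.comp_def] using (Complex.continuous_re.tendsto 0).comp h0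
  refine h1.congr' ?_
  filter_upwards [tendsto_ofReal_cofinite.eventually hF] with r hr
  have hc : ∀ f : ℝ[X], aeval (r : ℂ) f = ((f.eval r : ℝ) : ℂ) := fun f => by
    have := Polynomial.aeval_algebraMap_apply ℂ r f
    simpa using this
  rw [hr, hc, hc, ← Complex.ofReal_div, Complex.ofReal_re]

/-- A proper stable rational function is bounded near each point of the closed right
half-plane. -/
lemma IsProperStable.bounded_near {f : RatFunc ℝ} (hf : IsProperStable f) {s₀ : ℂ}
    (hs : 0 ≤ s₀.re) : ∃ C : ℝ, ∀ᶠ ε : ℝ in 𝓝[>] 0, ‖evalAt f (s₀ + ε)‖ ≤ C := by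
  have hd : aeval s₀ f.denom ≠ 0 := fun h => (hf.2 s₀ h).not_ge hs
  have hc : ContinuousAt (evalAt f) s₀ :=
    ((Polynomial.continuous_aeval f.num).continuousAt).div
      ((Polynomial.continuous_aeval f.denom).continuousAt) hd
  have ht : Tendsto (fun ε : ℝ => ‖evalAt f (s₀ + ε)‖) (𝓝[>] 0) (𝓝 ‖evalAt f s₀‖) :=
    (hc.tendsto.comp ((tendsto_add_ofReal_nhdsNE s₀).mono_right nhdsWithin_le_nhds)).norm
  exact ⟨_, ht.eventually (eventually_le_nhds (lt_add_one _))⟩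

/-- A proper rational function is bounded at infinity along the positive real axis. -/
lemma IsProperStable.bounded_atTop {f : RatFunc ℝ} (hf : IsProperStable f) :
    ∃ C : ℝ, ∀ᶠ r : ℝ in atTop, ‖evalAt f r‖ ≤ C := by
  have hdeg : f.num.degree ≤ f.denom.degree := by
    rw [degree_eq_natDegree f.denom_ne_zero]
    exact degree_le_of_natDegree_le hf.1
  obtain ⟨C, hC⟩ := (Polynomial.isBigO_atTop_of_degree_le f.num f.denom hdeg).bound
  refine ⟨C, ?_⟩
  filter_upwards [hC, eventually_atTop_not_isRoot _ f.denom_ne_zero] with r hr hr0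
  have hc : ∀ f : ℝ[X], aeval (r : ℂ) f = ((f.eval r : ℝ) : ℂ) := fun f => by
    have := Polynomial.aeval_algebraMap_apply ℂ r f
    simpa using this
  have : evalAt f r = aeval (r : ℂ) f.num / aeval (r : ℂ) f.denom := rfl
  rw [this, hc, hc, ← Complex.ofReal_div, Complex.norm_real, norm_div,
    div_le_iff₀ (norm_pos_iff.2 hr0)]
  exact hr

/-! ### Laplace transforms of exponential polynomials -/

/-- `g` has an absolutely convergent Laplace transform on some right half-plane, equal to `F`. -/
def HasLaplace (g : ℝ → ℂ) (F : ℂ → ℂ) : Prop :=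
  ∃ σ : ℝ, ∀ s : ℂ, σ < s.re →
    IntegrableOn (fun t : ℝ => Complex.exp (-s * t) * g t) (Set.Ioi 0) ∧
    ∫ t in Set.Ioi (0 : ℝ), Complex.exp (-s * t) * g t = F s

lemma integrableOn_pow_mul_cexp (k : ℕ) {w : ℂ} (hw : 0 < w.re) :
    IntegrableOn (fun t : ℝ => (t : ℂ) ^ k * Complex.exp (-w * t)) (Set.Ioi 0) := by
  have hr := integrableOn_rpow_mul_exp_neg_mul_rpow (p := 1) (s := k) (b := w.re)
    (by have : (0 : ℝ) ≤ k := k.cast_nonneg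
        linarith) one_pos hw
  refine (Integrable.mono' hr ?_ ?_)
  · exact (by fun_prop : Continuous fun t : ℝ =>
      (t : ℂ) ^ k * Complex.exp (-w * t)).aestronglyMeasurable
  · filter_upwards [ae_restrict_mem measurableSet_Ioi] with t ht
    have ht' : (0 : ℝ) ≤ t := le_of_lt ht
    simp [Complex.norm_exp, abs_of_nonneg ht']

lemma tendsto_pow_mul_cexp (k : ℕ) {w : ℂ} (hw : 0 < w.re) :
    Tendsto (fun t : ℝ => (t : ℂ) ^ k * Complex.exp (-w * t)) atTop (𝓝 0) := by
  rw [tendsto_zero_iff_norm_tendsto_zero]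
  have h := (isLittleO_pow_exp_pos_mul_atTop (k := k) hw).tendsto_div_nhds_zero
  have h' := h.norm
  rw [norm_zero] at h'
  refine h'.congr fun t => ?_
  simp [Complex.norm_exp, Real.exp_neg, div_eq_mul_inv]

lemma hasDerivAt_pow_mul_cexp (k : ℕ) (l : ℂ) (t : ℝ) :
    HasDerivAt (fun t : ℝ => (t : ℂ) ^ k * Complex.exp (l * t))
      (k * ((t : ℂ) ^ (k - 1) * Complex.exp (l * t)) + l * ((t : ℂ) ^ k * Complex.exp (l * t)))
      t := by
  have h1 : HasDerivAt (fun z : ℂ => z ^ k * Complex.exp (l * z))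
      (k * ((t : ℂ) ^ (k - 1) * Complex.exp (l * t)) + l * ((t : ℂ) ^ k * Complex.exp (l * t)))
      (t : ℂ) := by
    have := (hasDerivAt_pow k (t : ℂ)).mul (((hasDerivAt_id (t : ℂ)).const_mul l).cexp)
    refine this.congr_deriv ?_
    simp only [id]
    ring
  exact h1.comp_ofReal

/-- The derivative of t^(k+1) e^(-wt) integrates to zero over the half-line, which gives the
factorial recursion. -/
lemma integral_pow_mul_cexp (k : ℕ) {w : ℂ} (hw : 0 < w.re) :
    ∫ t in Set.Ioi (0 : ℝ), (t : ℂ) ^ k * Complex.exp (-w * t) = k.factorial / w ^ (k + 1) := by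
  have hw0 : w ≠ 0 := fun h => by simp [h] at hw
  induction k with
  | zero =>
    have := integral_exp_mul_complex_Ioi (a := -w) (by simpa using hw) 0
    simpa using this
  | succ k ih =>
    have hd := fun t (_ : t ∈ Set.Ici (0 : ℝ)) => hasDerivAt_pow_mul_cexp (k + 1) (-w) t
    have hi1 := (integrableOn_pow_mul_cexp k hw).const_mul ((k + 1 : ℕ) : ℂ)
    have hi2 := (integrableOn_pow_mul_cexp (k + 1) hw).const_mul (-w)
    have h := integral_Ioi_of_hasDerivAt_of_tendsto' hd (hi1.add hi2)
      (tendsto_pow_mul_cexp (k + 1) hw)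
    simp only [Nat.add_sub_cancel] at h
    rw [integral_add hi1 hi2, integral_const_mul, integral_const_mul, ih] at h
    simp only [Complex.ofReal_zero, ne_eq, Nat.add_eq_zero_iff, one_ne_zero, and_false,
      not_false_eq_true, zero_pow, zero_mul, sub_zero] at h
    have h2 : w * ∫ t in Set.Ioi (0 : ℝ), (t : ℂ) ^ (k + 1) * Complex.exp (-w * t) =
        ((k + 1 : ℕ) : ℂ) * (k.factorial / w ^ (k + 1)) := by linear_combination -h
    apply mul_left_cancel₀ hw0
    rw [h2, Nat.factorial_succ]
    push_cast
    field_simp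
    ring

/-- Exponential polynomials with exponents in `S`. -/
def expPoly (S : Set ℂ) : Submodule ℂ (ℝ → ℂ) :=
  Submodule.span ℂ {g | ∃ k : ℕ, ∃ l ∈ S, g = fun t : ℝ => (t : ℂ) ^ k * Complex.exp (l * t)}

lemma pow_mul_cexp_mem_expPoly {S : Set ℂ} (k : ℕ) {l : ℂ} (hl : l ∈ S) :
    (fun t : ℝ => (t : ℂ) ^ k * Complex.exp (l * t)) ∈ expPoly S :=
  Submodule.subset_span ⟨k, l, hl, rfl⟩

lemma expPoly_contDiff {S : Set ℂ} {g : ℝ → ℂ} (hg : g ∈ expPoly S) (n : ℕ) :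
    ContDiff ℝ n g := by
  induction hg using Submodule.span_induction with
  | mem g hg =>
    obtain ⟨k, l, -, rfl⟩ := hg
    have h : ContDiff ℝ n (fun t : ℝ => (t : ℂ)) := Complex.ofRealCLM.contDiff
    exact (h.pow k).mul (contDiff_const.mul h).cexp
  | zero => exact contDiff_const
  | add f g _ _ hf hg => exact hf.add hg
  | smul a f _ hf => exact hf.const_smul a

lemma expPoly_deriv {S : Set ℂ} {g : ℝ → ℂ} (hg : g ∈ expPoly S) :
    ∃ g' ∈ expPoly S, ∀ t, HasDerivAt g (g' t) t := by
  induction hg using Submodule.span_induction with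
  | mem g hg =>
    obtain ⟨k, l, hl, rfl⟩ := hg
    exact ⟨_, Submodule.add_mem _
      (Submodule.smul_mem _ (k : ℂ) (pow_mul_cexp_mem_expPoly (k - 1) hl))
      (Submodule.smul_mem _ l (pow_mul_cexp_mem_expPoly k hl)),
      fun t => hasDerivAt_pow_mul_cexp k l t⟩
  | zero => exact ⟨0, Submodule.zero_mem _, fun t => hasDerivAt_const t 0⟩
  | add f g _ _ hf hg =>
    obtain ⟨f', hf', hf⟩ := hf
    obtain ⟨g', hg', hg⟩ := hg
    exact ⟨f' + g', Submodule.add_mem _ hf' hg', fun t => (hf t).add (hg t)⟩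
  | smul a f _ hf =>
    obtain ⟨f', hf', hf⟩ := hf
    exact ⟨a • f', Submodule.smul_mem _ a hf', fun t => (hf t).const_smul a⟩

lemma expPoly_tendsto_zero {S : Set ℂ} (hS : ∀ l ∈ S, l.re < 0) {g : ℝ → ℂ}
    (hg : g ∈ expPoly S) : Tendsto g atTop (𝓝 0) := by
  induction hg using Submodule.span_induction with
  | mem g hg =>
    obtain ⟨k, l, hl, rfl⟩ := hg
    simpa using tendsto_pow_mul_cexp k (w := -l) (by simpa using hS l hl)
  | zero => exact tendsto_const_nhds
  | add f g _ _ hf hg => simpa [Pi.add_def] using hf.add hg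
  | smul a f _ hf => simpa [Pi.smul_def] using hf.const_smul a

lemma expPoly_iteratedDeriv_re {S : Set ℂ} {g : ℝ → ℂ} (hg : g ∈ expPoly S) (k : ℕ) :
    ∃ g' ∈ expPoly S, iteratedDeriv k (fun t => (g t).re) = fun t => (g' t).re := by
  induction k with
  | zero => exact ⟨g, hg, iteratedDeriv_zero⟩
  | succ k ih =>
    obtain ⟨g₁, hg₁, h₁⟩ := ih
    obtain ⟨g₂, hg₂, h₂⟩ := expPoly_deriv hg₁
    refine ⟨g₂, hg₂, ?_⟩
    rw [iteratedDeriv_succ, h₁]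
    funext t
    exact (Complex.reCLM.hasFDerivAt.comp_hasDerivAt t (h₂ t)).deriv

namespace HasLaplace

variable {g h : ℝ → ℂ} {F G : ℂ → ℂ}

lemma add (hg : HasLaplace g F) (hh : HasLaplace h G) : HasLaplace (g + h) (F + G) := by
  obtain ⟨σ, hσ⟩ := hg
  obtain ⟨τ, hτ⟩ := hh
  refine ⟨max σ τ, fun s hs => ?_⟩
  obtain ⟨h1, h2⟩ := hσ s ((le_max_left _ _).trans_lt hs)
  obtain ⟨h3, h4⟩ := hτ s ((le_max_right _ _).trans_lt hs)
  simp only [Pi.add_apply, mul_add]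
  exact ⟨h1.add h3, by rw [integral_add h1 h3, h2, h4]⟩

lemma const_smul (a : ℂ) (hg : HasLaplace g F) : HasLaplace (a • g) (a • F) := by
  obtain ⟨σ, hσ⟩ := hg
  refine ⟨σ, fun s hs => ?_⟩
  obtain ⟨h1, h2⟩ := hσ s hs
  simp only [Pi.smul_apply, smul_eq_mul, mul_left_comm _ a]
  exact ⟨h1.const_mul a, by rw [integral_const_mul, h2]⟩

lemma zero : HasLaplace 0 0 := ⟨0, fun s _ => by simp⟩

lemma pow_mul_cexp (k : ℕ) (l : ℂ) :
    HasLaplace (fun t : ℝ => (t : ℂ) ^ k * Complex.exp (l * t))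
      (fun s => k.factorial / (s - l) ^ (k + 1)) := by
  refine ⟨l.re, fun s hs => ?_⟩
  have hw : 0 < (s - l).re := by simpa using hs
  have he : (fun t : ℝ => Complex.exp (-s * t) * ((t : ℂ) ^ k * Complex.exp (l * t))) =
      fun t : ℝ => (t : ℂ) ^ k * Complex.exp (-(s - l) * t) := by
    funext t
    rw [mul_left_comm, ← Complex.exp_add]
    ring_nf
  rw [he]
  exact ⟨integrableOn_pow_mul_cexp k hw, integral_pow_mul_cexp k hw⟩

/-- A finite exceptional set lies to the left of some vertical line, so enlarging the abscissa
avoids it. -/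
lemma congr' (hg : HasLaplace g F) (h : ∀ᶠ s in cofinite, F s = G s) : HasLaplace g G := by
  obtain ⟨σ, hσ⟩ := hg
  obtain ⟨b, hb⟩ := ((show {s | ¬F s = G s}.Finite from h).image Complex.re).bddAbove
  refine ⟨max σ b, fun s hs => ?_⟩
  obtain ⟨h1, h2⟩ := hσ s ((le_max_left _ _).trans_lt hs)
  refine ⟨h1, h2.trans ?_⟩
  by_contra hne
  exact ((le_max_right _ _).trans_lt hs).not_ge (hb ⟨s, hne, rfl⟩)

/-- The conjugate of g has transform s ↦ conj F(conj s), which is F again under the symmetry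
hypothesis; Re g is the average of g and its conjugate. -/
lemma re (hg : HasLaplace g F) (hF : ∀ s, F (star s) = star (F s)) :
    HasLaplace (fun t => ((g t).re : ℂ)) F := by
  obtain ⟨σ, hσ⟩ := hg
  refine ⟨σ, fun s hs => ?_⟩
  obtain ⟨h1, h2⟩ := hσ s hs
  obtain ⟨h3, h4⟩ := hσ (star s) (by simpa using hs)
  have he : (fun t : ℝ => Complex.exp (-s * t) * star (g t)) =
      fun t : ℝ => (starRingEnd ℂ) (Complex.exp (-star s * t) * g t) := by
    funext t
    simp [← Complex.exp_conj]
  have h5 : IntegrableOn (fun t : ℝ => Complex.exp (-s * t) * star (g t)) (Set.Ioi 0) := by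
    rw [he]
    exact Complex.conjCLE.toContinuousLinearMap.integrable_comp h3
  have h6 : ∫ t in Set.Ioi (0 : ℝ), Complex.exp (-s * t) * star (g t) = F s := by
    rw [he, integral_conj, h4, hF]
    exact star_star _
  have he' : (fun t : ℝ => Complex.exp (-s * t) * ((g t).re : ℂ)) = fun t : ℝ =>
      (1 / 2 : ℂ) * (Complex.exp (-s * t) * g t + Complex.exp (-s * t) * star (g t)) := by
    funext t
    rw [Complex.re_eq_add_conj]
    simp only [starRingEnd_apply]
    ring
  rw [he']
  exact ⟨(h1.add h5).const_mul _, by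
    rw [integral_const_mul, integral_add h1 h5, h2, h6]
    ring⟩

end HasLaplace

/-! ### Partial fractions -/

/-- Linear combinations of the functions `1 / (s - l) ^ (k + 1)`, with poles `l` in `S`. -/
def simpleFractions (S : Set ℂ) : Submodule ℂ (ℂ → ℂ) :=
  Submodule.span ℂ {F | ∃ k : ℕ, ∃ l ∈ S, F = fun s => 1 / (s - l) ^ (k + 1)}

lemma simpleFraction_mem {S : Set ℂ} (k : ℕ) {l : ℂ} (hl : l ∈ S) :
    (fun s => 1 / (s - l) ^ (k + 1)) ∈ simpleFractions S :=
  Submodule.subset_span ⟨k, l, hl, rfl⟩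

lemma exists_hasLaplace_of_mem_simpleFractions {S : Set ℂ} {F : ℂ → ℂ}
    (hF : F ∈ simpleFractions S) : ∃ g ∈ expPoly S, HasLaplace g F := by
  induction hF using Submodule.span_induction with
  | mem F hF =>
    obtain ⟨k, l, hl, rfl⟩ := hF
    refine ⟨_, Submodule.smul_mem _ (1 / (k.factorial : ℂ)) (pow_mul_cexp_mem_expPoly k hl), ?_⟩
    convert! (HasLaplace.pow_mul_cexp k l).const_smul (1 / (k.factorial : ℂ)) using 1
    funext s
    have : (k.factorial : ℂ) ≠ 0 := by exact_mod_cast k.factorial_ne_zero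
    simp only [Pi.smul_apply, smul_eq_mul]
    field_simp
  | zero => exact ⟨0, Submodule.zero_mem _, HasLaplace.zero⟩
  | add F G _ _ hF hG =>
    obtain ⟨g, hg, h1⟩ := hF
    obtain ⟨h, hh, h2⟩ := hG
    exact ⟨g + h, Submodule.add_mem _ hg hh, h1.add h2⟩
  | smul a F _ hF =>
    obtain ⟨g, hg, h1⟩ := hF
    exact ⟨a • g, Submodule.smul_mem _ a hg, h1.const_smul a⟩

lemma eventually_cofinite_sub_ne_zero (a : ℂ) : ∀ᶠ s in cofinite, s - a ≠ 0 := by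
  filter_upwards [(Set.finite_singleton a).compl_mem_cofinite] with s hs
  exact sub_ne_zero.2 hs

lemma simpleFraction_div {S : Set ℂ} {l m : ℂ} (hl : l ∈ S) (hm : m ∈ S) (k : ℕ) :
    ∃ G ∈ simpleFractions S, ∀ᶠ s in cofinite, G s = 1 / (s - l) ^ (k + 1) / (s - m) := by
  rcases eq_or_ne l m with rfl | hlm
  · exact ⟨_, simpleFraction_mem (k + 1) hl, Eventually.of_forall fun s => by
      rw [pow_succ _ (k + 1), div_div]⟩
  have h0 : l - m ≠ 0 := sub_ne_zero.2 hlm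
  -- For l ≠ m, 1/((s-l)^(k+1)(s-m)) is 1/(l-m) times the difference of 1/(s-l)^(k+1) and
  -- 1/((s-l)^k(s-m)), which lowers the exponent.
  have key : ∀ k, ∀ G₀ ∈ simpleFractions S, (∀ᶠ s in cofinite, G₀ s = 1 / (s - l) ^ k / (s - m)) →
      ∃ G ∈ simpleFractions S, ∀ᶠ s in cofinite, G s = 1 / (s - l) ^ (k + 1) / (s - m) := by
    intro k G₀ hG₀ h
    refine ⟨(1 / (l - m)) • ((fun s => 1 / (s - l) ^ (k + 1)) - G₀), Submodule.smul_mem _ _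
      (Submodule.sub_mem _ (simpleFraction_mem k hl) hG₀), ?_⟩
    filter_upwards [h, eventually_cofinite_sub_ne_zero l, eventually_cofinite_sub_ne_zero m]
      with s h₁ h₂ h₃
    simp only [Pi.smul_apply, Pi.sub_apply, smul_eq_mul, h₁]
    field_simp
    ring
  induction k with
  | zero =>
    exact key 0 _ (simpleFraction_mem 0 hm) (Eventually.of_forall fun s => by simp)
  | succ k ih =>
    obtain ⟨G₀, hG₀, h⟩ := ih
    exact key (k + 1) G₀ hG₀ h

lemma simpleFractions_div {S : Set ℂ} {m : ℂ} (hm : m ∈ S) {F : ℂ → ℂ}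
    (hF : F ∈ simpleFractions S) :
    ∃ G ∈ simpleFractions S, ∀ᶠ s in cofinite, G s = F s / (s - m) := by
  induction hF using Submodule.span_induction with
  | mem F hF =>
    obtain ⟨k, l, hl, rfl⟩ := hF
    exact simpleFraction_div hl hm k
  | zero => exact ⟨0, Submodule.zero_mem _, by simp⟩
  | add F G _ _ hF hG =>
    obtain ⟨F', hF', h1⟩ := hF
    obtain ⟨G', hG', h2⟩ := hG
    refine ⟨F' + G', Submodule.add_mem _ hF' hG', ?_⟩
    filter_upwards [h1, h2] with s h₁ h₂
    simp [h₁, h₂, add_div]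
  | smul a F _ hF =>
    obtain ⟨F', hF', h1⟩ := hF
    refine ⟨a • F', Submodule.smul_mem _ a hF', ?_⟩
    filter_upwards [h1] with s h₁
    simp [h₁, mul_div_assoc]

/-- Partial fraction decomposition of a strictly proper rational function. -/
lemma exists_simpleFractions {S : Set ℂ} (m : Multiset ℂ) :
    (∀ a ∈ m, a ∈ S) → ∀ p : ℂ[X], p.degree < m.card → ∃ F ∈ simpleFractions S,
      ∀ᶠ s in cofinite, F s = p.eval s / (m.map fun a => s - a).prod := by
  induction m using Multiset.induction_on with
  | empty =>
    intro _ p hp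
    have : p = 0 := by
      rw [← degree_eq_bot]
      simpa [Nat.WithBot.lt_zero_iff] using hp
    exact ⟨0, Submodule.zero_mem _, by simp [this]⟩
  | cons a m ih =>
    intro hS p hp
    have ha : a ∈ S := hS a (by simp)
    have hm : ∀ b ∈ m, b ∈ S := fun b hb => hS b (by simp [hb])
    -- Writing p = p(a) + (X - a)p₁ splits the fraction into p₁ over the product for m, covered by
    -- induction, and the constant p(a) over the full product, reached by dividing by one linear
    -- factor at a time.
    have hdiv := modByMonic_add_div p (X - C a)
    have hmod : p %ₘ (X - C a) = C (p.eval a) := modByMonic_X_sub_C_eq_C_eval p a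
    have hdeg : (p /ₘ (X - C a)).degree < m.card := by
      by_cases h0 : p /ₘ (X - C a) = 0
      · rw [h0, degree_zero]
        exact WithBot.bot_lt_coe _
      have hp0 : p ≠ 0 := fun h => h0 (by simp [h])
      rw [degree_eq_natDegree h0, natDegree_divByMonic _ (monic_X_sub_C a), natDegree_X_sub_C]
      rw [degree_eq_natDegree hp0, Multiset.card_cons] at hp
      have hp' : p.natDegree < m.card + 1 := by exact_mod_cast hp
      have hd : 1 ≤ p.natDegree := by
        by_contra hlt
        apply h0
        rw [divByMonic_eq_zero_iff (monic_X_sub_C a), degree_X_sub_C, degree_eq_natDegree hp0]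
        exact_mod_cast (by omega : p.natDegree < 1)
      exact_mod_cast (by omega : p.natDegree - 1 < m.card)
    obtain ⟨F₁, hF₁, h₁⟩ := ih hm _ hdeg
    obtain ⟨F₂, hF₂, h₂⟩ : ∃ F ∈ simpleFractions S, ∀ᶠ s in cofinite,
        F s = p.eval a / (s - a) / (m.map fun a => s - a).prod := by
      clear ih hp hdeg hS h₁
      induction m using Multiset.induction_on with
      | empty =>
        refine ⟨p.eval a • fun s => 1 / (s - a) ^ (0 + 1),
          Submodule.smul_mem _ _ (simpleFraction_mem 0 ha), Eventually.of_forall fun s => ?_⟩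
        simp [div_eq_mul_inv]
      | cons b m ih =>
        obtain ⟨F, hF, h⟩ := ih fun b hb => hm b (by simp [hb])
        obtain ⟨G, hG, h'⟩ := simpleFractions_div (hm b (by simp)) hF
        refine ⟨G, hG, ?_⟩
        filter_upwards [h, h'] with s h₁ h₂
        rw [h₂, h₁, Multiset.map_cons, Multiset.prod_cons, div_div, mul_comm (s - b)]
    refine ⟨F₁ + F₂, Submodule.add_mem _ hF₁ hF₂, ?_⟩
    filter_upwards [h₁, h₂, eventually_cofinite_sub_ne_zero a] with s e₁ e₂ e₃
    have hev : p.eval s = p.eval a + (s - a) * (p /ₘ (X - C a)).eval s := by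
      conv_lhs => rw [← hdiv, hmod]
      simp
    rw [Pi.add_apply, e₁, e₂, hev, Multiset.map_cons, Multiset.prod_cons, add_div,
      mul_div_mul_left _ _ e₃, div_div, add_comm]

/-- A strictly proper real rational function is the Laplace transform of the real part of an
exponential polynomial whose exponents are its poles. -/
lemma exists_hasLaplace_re {p q : ℝ[X]} (h : p.degree < q.degree) :
    ∃ g ∈ expPoly {l : ℂ | aeval l q = 0},
      HasLaplace (fun t => ((g t).re : ℂ)) fun s => aeval s p / aeval s q := by
  have hq : q ≠ 0 := fun h0 => by simp [h0] at h
  set Q : ℂ[X] := q.map (algebraMap ℝ ℂ) with hQ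
  have hQ0 : Q ≠ 0 := by
    rwa [hQ, Ne, Polynomial.map_eq_zero_iff (algebraMap ℝ ℂ).injective]
  have hcard : (Q.roots.card : WithBot ℕ) = q.degree := by
    rw [← (IsAlgClosed.splits Q).degree_eq_card_roots hQ0, hQ, degree_map]
  -- The leading coefficient of q moves into the numerator, leaving the product over the roots as
  -- denominator.
  obtain ⟨F, hF, hF'⟩ := exists_simpleFractions (S := {l : ℂ | aeval l q = 0}) Q.roots
    (fun a ha => by simpa [hQ, hQ0, eval_map_algebraMap] using (mem_roots hQ0).1 ha)
    (C Q.leadingCoeff⁻¹ * p.map (algebraMap ℝ ℂ)) (by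
      rw [hcard, degree_C_mul (inv_ne_zero (leadingCoeff_ne_zero.2 hQ0)), degree_map]
      exact h)
  obtain ⟨g, hg, hgF⟩ := exists_hasLaplace_of_mem_simpleFractions hF
  have hrat : ∀ s, aeval s q = Q.leadingCoeff * (Q.roots.map fun a => s - a).prod := by
    intro s
    have h1 := congrArg (eval s) (IsAlgClosed.splits Q).eq_prod_roots
    rw [hQ, eval_map_algebraMap, ← hQ] at h1
    rw [h1, eval_mul, eval_C, eval_multiset_prod, Multiset.map_map]
    simp
  refine ⟨g, hg, (hgF.congr' ?_).re ?_⟩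
  · filter_upwards [hF'] with s hs
    rw [hs, hrat, eval_mul, eval_C, eval_map_algebraMap, mul_comm, mul_div_assoc, div_eq_mul_inv,
      div_eq_mul_inv, mul_inv]
  · intro s
    have hc : ∀ f : ℝ[X], aeval (star s) f = star (aeval s f) := fun f => by
      have := Polynomial.aeval_conj f s
      simpa using this
    rw [hc, hc]
    simp

/-! ### Injectivity of the Laplace transform -/

/-- A function that is continuous on the positive half-line is determined there by its Laplace
transform. -/
lemma HasLaplace.eq_zero {h : ℝ → ℂ} (hh : HasLaplace h fun _ => 0)
    (hc : ContinuousOn h (Set.Ioi 0)) : ∀ t, 0 < t → h t = 0 := by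
  obtain ⟨σ, hσ⟩ := hh
  intro t ht
  -- On the line Re s = σ + 1 the Laplace transform of h is the Fourier transform of f, at frequency
  -- w for s = σ + 1 + 2πiw. It vanishes, so it is integrable and Fourier inversion holds at each
  -- continuity point of f.
  set f : ℝ → ℂ := (Set.Ioi (0 : ℝ)).indicator
    fun t => Complex.exp (-((σ + 1 : ℝ) : ℂ) * t) * h t with hf
  have hfi : Integrable f := by
    rw [hf, integrable_indicator_iff measurableSet_Ioi]
    exact (hσ ((σ + 1 : ℝ) : ℂ) (by simp)).1
  have hF : FourierTransform.fourier f = 0 := by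
    funext w
    rw [Real.fourier_real_eq_integral_exp_smul]
    have h1 := (hσ (((σ + 1 : ℝ) : ℂ) + 2 * Real.pi * w * Complex.I) (by simp)).2
    refine Eq.trans ?_ h1
    rw [← integral_indicator measurableSet_Ioi]
    congr 1
    funext v
    by_cases hv : v ∈ Set.Ioi (0 : ℝ)
    · simp only [hf, Set.indicator_of_mem hv, smul_eq_mul]
      rw [← mul_assoc, ← Complex.exp_add]
      congr 2
      push_cast
      ring
    · simp [hf, Set.indicator_of_notMem hv]
  have hcf : ContinuousAt f t := by
    have h1 : ContinuousAt (fun t : ℝ => Complex.exp (-((σ + 1 : ℝ) : ℂ) * t) * h t) t :=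
      (by fun_prop : Continuous fun t : ℝ =>
        Complex.exp (-((σ + 1 : ℝ) : ℂ) * t)).continuousAt.mul
        (hc.continuousAt (Ioi_mem_nhds ht))
    refine h1.congr ?_
    filter_upwards [Ioi_mem_nhds ht] with v hv
    rw [hf, Set.indicator_of_mem hv]
  have hinv := hfi.fourierInv_fourier_eq (by rw [hF]; exact integrable_zero _ _ _) hcf
  rw [hF] at hinv
  have h0 : f t = 0 := by
    rw [← hinv]
    simp [Real.fourierInv_eq]
  rw [hf, Set.indicator_of_mem (Set.mem_Ioi.2 ht)] at h0
  exact (mul_eq_zero.1 h0).resolve_left (Complex.exp_ne_zero _)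

/-! ### The Hilbert space estimate -/

section Estimates

variable {H : Type*} [NormedAddCommGroup H] [InnerProductSpace ℂ H]

/-- The cross term is 2 Re(conj(s) r) = 2r Re s ≥ 0. -/
lemma norm_sq_add_norm_sq_le {s : ℂ} (hs : 0 ≤ s.re) {v w : H} {r : ℝ} (hr : 0 ≤ r)
    (hvw : inner ℂ v w = (r : ℂ)) : ‖s • v‖ ^ 2 + ‖w‖ ^ 2 ≤ ‖s • v + w‖ ^ 2 := by
  have h := norm_add_sq (𝕜 := ℂ) (s • v) w
  rw [inner_smul_left, hvw] at h
  have h2 : RCLike.re ((starRingEnd ℂ) s * (r : ℂ)) = s.re * r := by simp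
  rw [h2] at h
  have := mul_nonneg hs hr
  linarith

/-- The basic lower bound for a perturbation of `s • v + w`, where `w` is the image of `v` under
a positive operator. -/
lemma lower_bound {s : ℂ} (hs : 0 ≤ s.re) {v w e y : H} {r a b : ℝ} (hr : 0 ≤ r)
    (hvw : inner ℂ v w = (r : ℂ)) (ha : 0 ≤ a) (hb : 0 ≤ b)
    (he : ‖e‖ ≤ a * ‖s • v‖ + b * ‖w‖) (hy : s • v + w + e = y) :
    (1 - (a + b)) * ‖s • v‖ ≤ ‖y‖ ∧ (1 - (a + b)) * ‖w‖ ≤ ‖y‖ := by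
  have h1 := norm_sq_add_norm_sq_le hs hr hvw
  have hv : ‖s • v‖ ≤ ‖s • v + w‖ :=
    (sq_le_sq₀ (norm_nonneg _) (norm_nonneg _)).1 (by nlinarith [sq_nonneg ‖w‖])
  have hw : ‖w‖ ≤ ‖s • v + w‖ :=
    (sq_le_sq₀ (norm_nonneg _) (norm_nonneg _)).1 (by nlinarith [sq_nonneg ‖s • v‖])
  have h2 : ‖s • v + w‖ ≤ ‖y‖ + ‖e‖ := by
    rw [← hy]
    simpa using norm_sub_le (s • v + w + e) e
  have h3 := mul_le_mul_of_nonneg_left hv ha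
  have h4 := mul_le_mul_of_nonneg_left hw hb
  -- The error is absorbed: ‖e‖ ≤ (a + b)‖s • v + w‖.
  have h5 : (1 - (a + b)) * ‖s • v + w‖ ≤ ‖y‖ := by linarith
  rcases le_total 0 (1 - (a + b)) with h | h
  · exact ⟨(mul_le_mul_of_nonneg_left hv h).trans h5, (mul_le_mul_of_nonneg_left hw h).trans h5⟩
  · exact ⟨(mul_nonpos_of_nonpos_of_nonneg h (norm_nonneg _)).trans (norm_nonneg _),
      (mul_nonpos_of_nonpos_of_nonneg h (norm_nonneg _)).trans (norm_nonneg _)⟩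

end Estimates

/-! ### Laplacians and the disagreement space -/

section Laplacian

variable {N : ℕ} {W : Matrix (Fin N) (Fin N) ℝ}

lemma laplacian_mulVec (W : Matrix (Fin N) (Fin N) ℝ) (v : Fin N → ℂ) (i : Fin N) :
    ((laplacian W).map Complex.ofReal).mulVec v i = ∑ j, (W i j : ℂ) * (v i - v j) := by
  simp only [Matrix.mulVec, dotProduct, Matrix.map_apply, laplacian, Matrix.of_apply]
  rw [← Finset.add_sum_erase _ _ (Finset.mem_univ i),
    ← Finset.add_sum_erase _ (fun j => (W i j : ℂ) * (v i - v j)) (Finset.mem_univ i)]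
  simp only [if_true, sub_self, mul_zero, zero_add]
  push_cast
  rw [Finset.sum_mul, ← Finset.sum_add_distrib]
  refine Finset.sum_congr rfl fun j hj => ?_
  rw [if_neg (Finset.ne_of_mem_erase hj).symm]
  push_cast
  ring

lemma weight_symm (h : (laplacian W).IsSymm) (i j : Fin N) : W i j = W j i := by
  rcases eq_or_ne i j with rfl | hij
  · rfl
  · have := h.apply i j
    simp only [laplacian, Matrix.of_apply, if_neg hij, if_neg hij.symm] at this
    linarith

/-- The Laplacian acting on complex vectors. -/
noncomputable def laplacianCLM (W : Matrix (Fin N) (Fin N) ℝ) :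
    EuclideanSpace ℂ (Fin N) →L[ℂ] EuclideanSpace ℂ (Fin N) :=
  Matrix.toEuclideanCLM (n := Fin N) (𝕜 := ℂ) ((laplacian W).map Complex.ofReal)

lemma laplacianCLM_apply (v : EuclideanSpace ℂ (Fin N)) (i : Fin N) :
    laplacianCLM W v i = ∑ j, (W i j : ℂ) * (v i - v j) :=
  laplacian_mulVec W v i

/-- Symmetric weights let the double sum be averaged with its copy under i ↔ j. The bilinear form
serves twice: v = w gives positivity, and constant v shows that the range is orthogonal to the
constants. -/
lemma inner_laplacianCLM (h : (laplacian W).IsSymm) (v w : EuclideanSpace ℂ (Fin N)) :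
    inner ℂ v (laplacianCLM W w) =
      (1 / 2 : ℂ) * ∑ i, ∑ j, (W i j : ℂ) * (star (v i - v j) * (w i - w j)) := by
  have h1 : inner ℂ v (laplacianCLM W w) =
      ∑ i, ∑ j, (W i j : ℂ) * (star (v i) * (w i - w j)) := by
    simp only [PiLp.inner_apply, RCLike.inner_apply, laplacianCLM_apply, Finset.sum_mul]
    exact Finset.sum_congr rfl fun i _ => Finset.sum_congr rfl fun j _ => by
      simp only [starRingEnd_apply]
      ring
  have h2 : ∑ i, ∑ j, (W i j : ℂ) * (star (v i) * (w i - w j)) =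
      ∑ i, ∑ j, (W i j : ℂ) * (star (v j) * (w j - w i)) := by
    rw [Finset.sum_comm]
    exact Finset.sum_congr rfl fun i _ => Finset.sum_congr rfl fun j _ => by
      rw [weight_symm h]
  have h3 : ∑ i, ∑ j, (W i j : ℂ) * (star (v i - v j) * (w i - w j)) =
      ∑ i, ∑ j, (W i j : ℂ) * (star (v i) * (w i - w j)) +
        ∑ i, ∑ j, (W i j : ℂ) * (star (v j) * (w j - w i)) := by
    simp only [← Finset.sum_add_distrib]
    exact Finset.sum_congr rfl fun i _ => Finset.sum_congr rfl fun j _ => by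
      rw [star_sub]
      ring
  rw [h3, ← h2, h1]
  ring

lemma inner_self_laplacianCLM (h : (laplacian W).IsSymm) (v : EuclideanSpace ℂ (Fin N)) :
    inner ℂ v (laplacianCLM W v) =
      ((1 / 2 * ∑ i, ∑ j, W i j * ‖v i - v j‖ ^ 2 : ℝ) : ℂ) := by
  rw [inner_laplacianCLM h]
  push_cast
  congr 1
  refine Finset.sum_congr rfl fun i _ => Finset.sum_congr rfl fun j _ => ?_
  rw [← Complex.conj_mul' (v i - v j)]
  rfl

lemma exists_inner_laplacianCLM (hW : ∀ i j, 0 ≤ W i j) (h : (laplacian W).IsSymm)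
    (v : EuclideanSpace ℂ (Fin N)) :
    ∃ r : ℝ, 0 ≤ r ∧ inner ℂ v (laplacianCLM W v) = (r : ℂ) :=
  ⟨_, mul_nonneg (by norm_num) (Finset.sum_nonneg fun i _ => Finset.sum_nonneg fun j _ =>
    mul_nonneg (hW i j) (sq_nonneg _)), inner_self_laplacianCLM h v⟩

/-- A vanishing sum of nonnegative terms forces equal values across every edge, and equality
propagates along paths from the root of the spanning tree. -/
lemma eq_of_laplacianCLM_eq_zero (hW : ∀ i j, 0 ≤ W i j) (h : (laplacian W).IsSymm)
    (ht : HasConnectedSpanningTree W) {v : EuclideanSpace ℂ (Fin N)}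
    (hv : laplacianCLM W v = 0) (i j : Fin N) : v i = v j := by
  have hs := inner_self_laplacianCLM h v
  rw [hv, inner_zero_right] at hs
  have hs' : ∑ i, ∑ j, W i j * ‖v i - v j‖ ^ 2 = 0 := by
    have := Complex.ofReal_eq_zero.1 hs.symm
    linarith
  have hnn : ∀ i j, 0 ≤ W i j * ‖v i - v j‖ ^ 2 := fun i j => mul_nonneg (hW i j) (sq_nonneg _)
  have hedge : ∀ i j, 0 < W i j → v i = v j := by
    intro i j hij
    have h1 := (Finset.sum_eq_zero_iff_of_nonneg
      fun i _ => Finset.sum_nonneg fun j _ => hnn i j).1 hs' i (Finset.mem_univ i)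
    have h2 := (Finset.sum_eq_zero_iff_of_nonneg fun j _ => hnn i j).1 h1 j (Finset.mem_univ j)
    have h3 := (mul_eq_zero.1 h2).resolve_left hij.ne'
    exact sub_eq_zero.1 (norm_eq_zero.1 (pow_eq_zero_iff two_ne_zero |>.1 h3))
  obtain ⟨r, hr⟩ := ht
  have hpath : ∀ k, v k = v r := by
    intro k
    induction hr k with
    | refl => rfl
    | tail _ hbc ih => exact (hedge _ _ hbc).trans ih
  rw [hpath i, hpath j]

/-- The vector all of whose entries are `1`. -/
def onesVec (N : ℕ) : EuclideanSpace ℂ (Fin N) := WithLp.toLp 2 fun _ => 1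

/-- The orthogonal projection onto the disagreement space, the orthogonal complement of the
consensus vectors. -/
noncomputable def disagreement (N : ℕ) : EuclideanSpace ℂ (Fin N) →L[ℂ] EuclideanSpace ℂ (Fin N) :=
  (ℂ ∙ onesVec N)ᗮ.starProjection

lemma norm_disagreement_le (v : EuclideanSpace ℂ (Fin N)) : ‖disagreement N v‖ ≤ ‖v‖ :=
  Submodule.norm_starProjection_apply_le _ v

lemma exists_sub_disagreement (v : EuclideanSpace ℂ (Fin N)) :
    ∃ c : ℂ, v - disagreement N v = c • onesVec N := by
  have h : v - disagreement N v ∈ (ℂ ∙ onesVec N)ᗮᗮ := Submodule.sub_starProjection_mem_orthogonal v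
  rw [Submodule.orthogonal_orthogonal] at h
  obtain ⟨c, hc⟩ := Submodule.mem_span_singleton.1 h
  exact ⟨c, hc.symm⟩

lemma disagreement_sub_apply (v : EuclideanSpace ℂ (Fin N)) (i j : Fin N) :
    disagreement N v i - disagreement N v j = v i - v j := by
  obtain ⟨c, hc⟩ := exists_sub_disagreement v
  have hi : ∀ i, v i - disagreement N v i = c := fun i => by
    have := congrArg (fun w : EuclideanSpace ℂ (Fin N) => w i) hc
    simpa [onesVec] using this
  linear_combination hi j - hi i

lemma laplacianCLM_disagreement (v : EuclideanSpace ℂ (Fin N)) :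
    laplacianCLM W (disagreement N v) = laplacianCLM W v := by
  ext i
  simp only [laplacianCLM_apply, disagreement_sub_apply]

lemma disagreement_laplacianCLM (h : (laplacian W).IsSymm) (v : EuclideanSpace ℂ (Fin N)) :
    disagreement N (laplacianCLM W v) = laplacianCLM W v := by
  refine Submodule.starProjection_eq_self_iff.2 ?_
  rw [Submodule.mem_orthogonal_singleton_iff_inner_right, inner_laplacianCLM h]
  simp [onesVec]

/-- On disagreements the Laplacian of a connected graph is bounded below. -/
lemma exists_norm_disagreement_le (hW : ∀ i j, 0 ≤ W i j) (h : (laplacian W).IsSymm)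
    (ht : HasConnectedSpanningTree W) :
    ∃ c : ℝ, 0 ≤ c ∧ ∀ v, ‖disagreement N v‖ ≤ c * ‖laplacianCLM W v‖ := by
  -- In finite dimension injectivity suffices for a lower bound; a kernel vector is constant and
  -- orthogonal to the constants, hence zero.
  obtain ⟨K, -, hK⟩ := LinearMap.exists_antilipschitzWith
    ((laplacianCLM W).toLinearMap.domRestrict (ℂ ∙ onesVec N)ᗮ) (by
      rw [LinearMap.ker_eq_bot']
      rintro ⟨v, hv⟩ h0
      have h0' : laplacianCLM W v = 0 := h0
      have hc := eq_of_laplacianCLM_eq_zero hW h ht h0'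
      rw [Submodule.mem_orthogonal_singleton_iff_inner_right] at hv
      refine Subtype.ext (PiLp.ext fun i => ?_)
      have : v = v i • onesVec N := PiLp.ext fun j => by simp [onesVec, hc j i]
      rw [this, inner_smul_right, mul_eq_zero, inner_self_eq_zero] at hv
      rcases hv with hv | hv
      · exact hv
      · have := congrArg (fun w : EuclideanSpace ℂ (Fin N) => w i) hv
        simp [onesVec] at this)
  refine ⟨K, K.2, fun v => ?_⟩
  have h1 := hK.le_mul_dist
    (⟨disagreement N v, Submodule.starProjection_apply_mem _ v⟩ : (ℂ ∙ onesVec N)ᗮ) 0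
  rw [map_zero, dist_zero_right, dist_zero_right] at h1
  rw [← laplacianCLM_disagreement]
  exact h1

end Laplacian

/-! ### Uniform bounds on the open right half-plane -/

section Bounds

variable {N : ℕ}

lemma norm_evalMatrix_le {Δ : Matrix (Fin N) (Fin N) (RatFunc ℝ)} (h : hInfNorm Δ < 1) {s : ℂ}
    (hs : 0 < s.re) (v : EuclideanSpace ℂ (Fin N)) :
    ‖Matrix.toEuclideanCLM (n := Fin N) (𝕜 := ℂ) (evalMatrix Δ s) v‖ ≤
      (hInfNorm Δ).toReal * ‖v‖ := by
  refine ContinuousLinearMap.le_of_opNorm_le _ ?_ v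
  rw [← toReal_enorm]
  exact ENNReal.toReal_mono h.ne_top (le_iSup₂ (f := fun (s : ℂ) (_ : 0 < s.re) =>
    ‖Matrix.toEuclideanCLM (n := Fin N) (𝕜 := ℂ) (evalMatrix Δ s)‖ₑ) s hs)

lemma innerFactor_apply (W : Matrix (Fin N) (Fin N) ℝ) (Δ : Matrix (Fin N) (Fin N) (RatFunc ℝ))
    (s : ℂ) (v : EuclideanSpace ℂ (Fin N)) :
    Matrix.toEuclideanCLM (n := Fin N) (𝕜 := ℂ) (innerFactor (laplacian W) Δ s) v =
      s • v + laplacianCLM W v +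
        Matrix.toEuclideanCLM (n := Fin N) (𝕜 := ℂ) (evalMatrix Δ s) (laplacianCLM W v) := by
  simp [innerFactor, laplacianCLM, add_mul, add_assoc]

lemma outerFactor_apply (W : Matrix (Fin N) (Fin N) ℝ)
    (Δ₀ Δ : Matrix (Fin N) (Fin N) (RatFunc ℝ)) (s : ℂ) (v : EuclideanSpace ℂ (Fin N)) :
    Matrix.toEuclideanCLM (n := Fin N) (𝕜 := ℂ) (outerFactor (laplacian W) Δ₀ Δ s) v =
      s • v + laplacianCLM W v +
        (Matrix.toEuclideanCLM (n := Fin N) (𝕜 := ℂ) (evalMatrix Δ₀ s) (s • v) +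
        Matrix.toEuclideanCLM (n := Fin N) (𝕜 := ℂ) (evalMatrix Δ s) (laplacianCLM W v)) := by
  simp only [outerFactor, laplacianCLM, add_mul, one_mul, map_add, map_smul, map_one, map_mul,
    add_apply, smul_apply, mul_apply_eq_comp,
    one_apply_eq_self]
  abel

variable {W : Matrix (Fin N) (Fin N) ℝ}

/-- `lower_bound` is applied to v and to Pv, P being the disagreement projection. As LP = L = PL,
projecting A(s)v gives sPv + Lv + PΔLv, of the same shape as A(s)v, so P can stand on both sides of
the second bound and such bounds compose. -/
lemma innerFactor_bound (hW : ∀ i j, 0 ≤ W i j) (h : (laplacian W).IsSymm)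
    (ht : HasConnectedSpanningTree W) {Δ : Matrix (Fin N) (Fin N) (RatFunc ℝ)}
    (hΔ : hInfNorm Δ < 1) : ∃ C : ℝ, 0 ≤ C ∧ ∀ s : ℂ, 0 < s.re → ∀ v,
      ‖s‖ * ‖v‖ ≤ C * ‖Matrix.toEuclideanCLM (n := Fin N) (𝕜 := ℂ)
        (innerFactor (laplacian W) Δ s) v‖ ∧
      ‖disagreement N v‖ ≤ C * ‖disagreement N (Matrix.toEuclideanCLM (n := Fin N) (𝕜 := ℂ)
        (innerFactor (laplacian W) Δ s) v)‖ := by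
  obtain ⟨c, hc, hcb⟩ := exists_norm_disagreement_le hW h ht
  set δ := (hInfNorm Δ).toReal with hδ
  have hδ0 : 0 ≤ δ := ENNReal.toReal_nonneg
  have hδ1 : 0 < 1 - δ := by
    have := (ENNReal.toReal_lt_toReal hΔ.ne_top ENNReal.one_ne_top).2 hΔ
    rw [ENNReal.toReal_one] at this
    linarith
  -- One constant covers both 1/(1-δ) and c/(1-δ).
  refine ⟨(1 + c) / (1 - δ), by positivity, fun s hs v => ⟨?_, ?_⟩⟩
  · obtain ⟨r, hr, hvr⟩ := exists_inner_laplacianCLM hW h v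
    have := (lower_bound hs.le hr hvr le_rfl hδ0
      (by simpa using norm_evalMatrix_le hΔ hs (laplacianCLM W v))
      (innerFactor_apply W Δ s v).symm).1
    rw [norm_smul, zero_add] at this
    rw [div_mul_eq_mul_div, le_div_iff₀ hδ1]
    nlinarith [mul_nonneg hc (norm_nonneg (Matrix.toEuclideanCLM (n := Fin N) (𝕜 := ℂ)
        (innerFactor (laplacian W) Δ s) v))]
  · obtain ⟨r, hr, hvr⟩ := exists_inner_laplacianCLM hW h (disagreement N v)
    rw [laplacianCLM_disagreement] at hvr
    have := (lower_bound hs.le hr hvr le_rfl hδ0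
      (by rw [zero_mul, zero_add]
          exact (norm_disagreement_le _).trans (norm_evalMatrix_le hΔ hs (laplacianCLM W v)))
      (y := disagreement N (Matrix.toEuclideanCLM (n := Fin N) (𝕜 := ℂ)
        (innerFactor (laplacian W) Δ s) v))
      (by rw [innerFactor_apply, map_add, map_add, map_smul, disagreement_laplacianCLM h])).2
    rw [zero_add] at this
    rw [div_mul_eq_mul_div, le_div_iff₀ hδ1]
    have h1 := mul_le_mul_of_nonneg_right (hcb v) hδ1.le
    have h2 := mul_le_mul_of_nonneg_left this hc
    nlinarith [norm_nonneg (disagreement N (Matrix.toEuclideanCLM (n := Fin N) (𝕜 := ℂ)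
        (innerFactor (laplacian W) Δ s) v))]

/-- The term sΔ₀v involves all of v, not only Pv, so the right side carries the full norm. This does
not chain further to the left, but the outer factor is leftmost. -/
lemma outerFactor_bound (hW : ∀ i j, 0 ≤ W i j) (h : (laplacian W).IsSymm)
    (ht : HasConnectedSpanningTree W) {Δ₀ Δ : Matrix (Fin N) (Fin N) (RatFunc ℝ)}
    (hΔ₀ : hInfNorm Δ₀ < 1) (hΔ : hInfNorm Δ < 1) (hadd : hInfNorm Δ₀ + hInfNorm Δ < 1) :
    ∃ C : ℝ, 0 ≤ C ∧ ∀ s : ℂ, 0 < s.re → ∀ v,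
      ‖s‖ * ‖v‖ ≤ C * ‖Matrix.toEuclideanCLM (n := Fin N) (𝕜 := ℂ)
        (outerFactor (laplacian W) Δ₀ Δ s) v‖ ∧
      ‖disagreement N v‖ ≤ C * ‖Matrix.toEuclideanCLM (n := Fin N) (𝕜 := ℂ)
        (outerFactor (laplacian W) Δ₀ Δ s) v‖ := by
  obtain ⟨c, hc, hcb⟩ := exists_norm_disagreement_le hW h ht
  have hδ1 : 0 < 1 - ((hInfNorm Δ₀).toReal + (hInfNorm Δ).toReal) := by
    have := (ENNReal.toReal_lt_toReal hadd.ne_top ENNReal.one_ne_top).2 hadd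
    rw [ENNReal.toReal_one, ENNReal.toReal_add hΔ₀.ne_top hΔ.ne_top] at this
    linarith
  refine ⟨(1 + c) / (1 - ((hInfNorm Δ₀).toReal + (hInfNorm Δ).toReal)), by positivity,
    fun s hs v => ?_⟩
  obtain ⟨r, hr, hvr⟩ := exists_inner_laplacianCLM hW h v
  obtain ⟨h1, h2⟩ := lower_bound hs.le hr hvr ENNReal.toReal_nonneg ENNReal.toReal_nonneg
    ((norm_add_le _ _).trans (add_le_add (norm_evalMatrix_le hΔ₀ hs (s • v))
      (norm_evalMatrix_le hΔ hs (laplacianCLM W v))))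
    (outerFactor_apply W Δ₀ Δ s v).symm
  rw [norm_smul] at h1
  have hn := norm_nonneg (Matrix.toEuclideanCLM (n := Fin N) (𝕜 := ℂ)
        (outerFactor (laplacian W) Δ₀ Δ s) v)
  constructor
  · rw [div_mul_eq_mul_div, le_div_iff₀ hδ1]
    nlinarith [mul_nonneg hc hn]
  · rw [div_mul_eq_mul_div, le_div_iff₀ hδ1]
    have h3 := mul_le_mul_of_nonneg_right (hcb v) hδ1.le
    have h4 := mul_le_mul_of_nonneg_left h2 hc
    nlinarith

lemma list_prod_bound {H ι : Type*} [NormedAddCommGroup H] [InnerProductSpace ℂ H]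
    (P : H →L[ℂ] H) (A : ι → ℂ → H →L[ℂ] H) (l : List ι)
    (hA : ∀ k ∈ l, ∃ C : ℝ, 0 ≤ C ∧ ∀ s : ℂ, 0 < s.re → ∀ v,
      ‖s‖ * ‖v‖ ≤ C * ‖A k s v‖ ∧ ‖P v‖ ≤ C * ‖P (A k s v)‖) :
    ∃ C : ℝ, 0 ≤ C ∧ ∀ s : ℂ, 0 < s.re → ∀ v,
      ‖s‖ ^ l.length * ‖v‖ ≤ C * ‖(l.map fun k => A k s).prod v‖ ∧
      ‖P v‖ ≤ C * ‖P ((l.map fun k => A k s).prod v)‖ := by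
  induction l with
  | nil => exact ⟨1, zero_le_one, fun s _ v => by simp⟩
  | cons k l ih =>
    obtain ⟨C, hC, h⟩ := ih fun k hk => hA k (by simp [hk])
    obtain ⟨C', hC', h'⟩ := hA k (by simp)
    refine ⟨C * C', mul_nonneg hC hC', fun s hs v => ?_⟩
    obtain ⟨h1, h2⟩ := h s hs v
    obtain ⟨h3, h4⟩ := h' s hs ((l.map fun k => A k s).prod v)
    rw [List.map_cons, List.prod_cons, mul_apply_eq_comp]
    refine ⟨?_, ?_⟩
    · calc ‖s‖ ^ (l.length + 1) * ‖v‖ = ‖s‖ * (‖s‖ ^ l.length * ‖v‖) := by ring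
        _ ≤ ‖s‖ * (C * ‖(l.map fun k => A k s).prod v‖) := by gcongr
        _ = C * (‖s‖ * ‖(l.map fun k => A k s).prod v‖) := by ring
        _ ≤ C * (C' * _) := by gcongr
        _ = _ := by ring
    · calc ‖P v‖ ≤ C * ‖P ((l.map fun k => A k s).prod v)‖ := h2
        _ ≤ C * (C' * _) := by gcongr
        _ = _ := by ring

/-- Uniform bounds on the open right half-plane for the inverse of the perturbed serial consensus
system, and sharper ones for the disagreement part of that inverse. -/
lemma perturbedSystem_bound (n : ℕ) (hn : 1 ≤ n) (W : ℕ → Matrix (Fin N) (Fin N) ℝ)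
    (hW : ∀ k, 1 ≤ k → k ≤ n → ∀ i j, 0 ≤ W k i j)
    (hsymm : ∀ k, 1 ≤ k → k ≤ n → (laplacian (W k)).IsSymm)
    (htree : ∀ k, 1 ≤ k → k ≤ n → HasConnectedSpanningTree (W k))
    (Δ : ℕ → Matrix (Fin N) (Fin N) (RatFunc ℝ))
    (hnorm : ∀ k, k ≤ n → hInfNorm (Δ k) < 1)
    (hnorm₀ : hInfNorm (Δ 0) + hInfNorm (Δ n) < 1) :
    ∃ C : ℝ, 0 ≤ C ∧ ∀ s : ℂ, 0 < s.re → ∀ v,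
      ‖s‖ ^ n * ‖v‖ ≤ C * ‖Matrix.toEuclideanCLM (n := Fin N) (𝕜 := ℂ)
        (perturbedSystem n (fun k => laplacian (W k)) Δ s) v‖ ∧
      ‖disagreement N v‖ ≤ C * ‖Matrix.toEuclideanCLM (n := Fin N) (𝕜 := ℂ)
        (perturbedSystem n (fun k => laplacian (W k)) Δ s) v‖ := by
  obtain ⟨C, hC, h⟩ := list_prod_bound (disagreement N)
    (fun k s => Matrix.toEuclideanCLM (n := Fin N) (𝕜 := ℂ)
      (innerFactor (laplacian (W k)) (Δ k) s)) (List.range' 1 (n - 1)) (fun k hk => by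
        rw [List.mem_range'_1] at hk
        have h1 : 1 ≤ k := hk.1
        have h2 : k ≤ n := by omega
        exact innerFactor_bound (hW k h1 h2) (hsymm k h1 h2) (htree k h1 h2) (hnorm k h2))
  obtain ⟨C', hC', h'⟩ := outerFactor_bound (hW n hn le_rfl) (hsymm n hn le_rfl)
    (htree n hn le_rfl) (hnorm 0 (Nat.zero_le _)) (hnorm n le_rfl) hnorm₀
  refine ⟨C * C', mul_nonneg hC hC', fun s hs v => ?_⟩
  obtain ⟨h1, h2⟩ := h s hs v
  set w := ((List.range' 1 (n - 1)).map fun k => Matrix.toEuclideanCLM (n := Fin N) (𝕜 := ℂ)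
    (innerFactor (laplacian (W k)) (Δ k) s)).prod v with hw
  obtain ⟨h3, h4⟩ := h' s hs w
  have he : Matrix.toEuclideanCLM (n := Fin N) (𝕜 := ℂ)
      (perturbedSystem n (fun k => laplacian (W k)) Δ s) v =
      Matrix.toEuclideanCLM (n := Fin N) (𝕜 := ℂ)
        (outerFactor (laplacian (W n)) (Δ 0) (Δ n) s) w := by
    rw [perturbedSystem, map_mul, map_list_prod, List.map_map, mul_apply_eq_comp]
    rfl
  rw [he]
  rw [List.length_range'] at h1
  refine ⟨?_, ?_⟩
  -- One power of s comes from the outer factor and n - 1 from the inner ones.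
  · calc ‖s‖ ^ n * ‖v‖ = ‖s‖ * (‖s‖ ^ (n - 1) * ‖v‖) := by
          conv_lhs => rw [← Nat.sub_add_cancel hn]
          ring
      _ ≤ ‖s‖ * (C * ‖w‖) := by gcongr
      _ = C * (‖s‖ * ‖w‖) := by ring
      _ ≤ C * (C' * _) := by gcongr
      _ = _ := by ring
  · calc ‖disagreement N v‖ ≤ C * ‖disagreement N w‖ := h2
      _ ≤ C * (C' * _) := by gcongr
      _ = _ := by ring

end Bounds

/-! ### Rationality of the solution -/

section Rationality

variable {N : ℕ}

lemma isRationalFn_factor (L : Matrix (Fin N) (Fin N) ℝ)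
    (Δ : Matrix (Fin N) (Fin N) (RatFunc ℝ)) (i j : Fin N) :
    IsRationalFn fun s => ((1 + evalMatrix Δ s) * L.map Complex.ofReal) i j :=
  IsRationalFn.matrix_mul (A := fun s => 1 + evalMatrix Δ s) (B := fun _ => L.map Complex.ofReal)
    (fun i j => by
      simp only [Matrix.add_apply, Matrix.one_apply]
      refine IsRationalFn.add ?_ (IsRationalFn.evalAt (Δ i j))
      split_ifs
      exacts [IsRationalFn.one, IsRationalFn.zero])
    (fun i j => IsRationalFn.ofReal (L i j)) i j

lemma isRationalFn_smul_one (i j : Fin N) :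
    IsRationalFn fun s : ℂ => (s • (1 : Matrix (Fin N) (Fin N) ℂ)) i j := by
  simp only [Matrix.smul_apply, Matrix.one_apply, smul_eq_mul]
  split_ifs
  · simpa using IsRationalFn.id
  · simpa using IsRationalFn.zero

lemma isRationalFn_perturbedSystem (n : ℕ) (L : ℕ → Matrix (Fin N) (Fin N) ℝ)
    (Δ : ℕ → Matrix (Fin N) (Fin N) (RatFunc ℝ)) (i j : Fin N) :
    IsRationalFn fun s => perturbedSystem n L Δ s i j := by
  have hinner : ∀ k i j, IsRationalFn fun s => innerFactor (L k) (Δ k) s i j := fun k i j =>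
    (isRationalFn_smul_one i j).add (isRationalFn_factor (L k) (Δ k) i j)
  have houter : ∀ i j, IsRationalFn fun s => outerFactor (L n) (Δ 0) (Δ n) s i j := fun i j =>
    ((isRationalFn_smul_one i j).add
      (IsRationalFn.id.mul (IsRationalFn.evalAt (Δ 0 i j)))).add
        (isRationalFn_factor (L n) (Δ n) i j)
  refine IsRationalFn.matrix_mul houter ?_ i j
  induction List.range' 1 (n - 1) with
  | nil =>
    intro i j
    simp only [List.map_nil, List.prod_nil, Matrix.one_apply]
    split_ifs
    exacts [IsRationalFn.one, IsRationalFn.zero]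
  | cons k l ih =>
    simp only [List.map_cons, List.prod_cons]
    exact IsRationalFn.matrix_mul (hinner k) ih

/-- The solution of `T(s) X = U(s)` given by Cramer's rule. -/
noncomputable def rationalSolution (T : ℂ → Matrix (Fin N) (Fin N) ℂ) (U : Fin N → RatFunc ℝ)
    (s : ℂ) (i : Fin N) : ℂ :=
  (T s).det⁻¹ * (T s).cramer (fun i => evalAt (U i) s) i

lemma isRationalFn_rationalSolution {T : ℂ → Matrix (Fin N) (Fin N) ℂ}
    (hT : ∀ i j, IsRationalFn fun s => T s i j) (U : Fin N → RatFunc ℝ) (i : Fin N) :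
    IsRationalFn fun s => rationalSolution T U s i := by
  simp only [rationalSolution, Matrix.cramer_apply]
  refine (IsRationalFn.det hT).inv.mul (IsRationalFn.det fun k l => ?_)
  simp only [Matrix.updateCol_apply]
  split_ifs
  exacts [IsRationalFn.evalAt (U k), hT k l]

lemma mulVec_rationalSolution {T : ℂ → Matrix (Fin N) (Fin N) ℂ} (U : Fin N → RatFunc ℝ) {s : ℂ}
    (hd : (T s).det ≠ 0) :
    (T s).mulVec (rationalSolution T U s) = fun i => evalAt (U i) s := by
  have : rationalSolution T U s = (T s).det⁻¹ • (T s).cramer fun i => evalAt (U i) s := rfl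
  rw [this, Matrix.mulVec_smul, Matrix.mulVec_cramer, smul_smul, inv_mul_cancel₀ hd, one_smul]

lemma norm_toLp_le (u : Fin N → ℂ) : ‖WithLp.toLp 2 u‖ ≤ ∑ i, ‖u i‖ := by
  rw [EuclideanSpace.norm_eq]
  exact Real.sqrt_le_iff.2 ⟨Finset.sum_nonneg fun i _ => norm_nonneg _,
    Finset.sum_sq_le_sq_sum_of_nonneg fun i _ => norm_nonneg _⟩

end Rationality

/-! ### Inverse Laplace transforms of rational functions -/

lemma IsRationalFn.exists_strictlyProper {F : ℂ → ℂ} (hF : IsRationalFn F)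
    (h0 : Tendsto (fun r : ℝ => F r) atTop (𝓝 0)) : ∃ p q : ℝ[X], IsCoprime p q ∧ q ≠ 0 ∧
    p.degree < q.degree ∧ ∀ᶠ s in cofinite, F s = aeval s p / aeval s q := by
  obtain ⟨p, q, hpq, hq, h⟩ := hF.exists_isCoprime
  exact ⟨p, q, hpq, hq, degree_lt_of_tendsto_zero h hq h0, h⟩

/-- A rational function that vanishes at infinity is the Laplace transform of a smooth real
function. -/
lemma IsRationalFn.exists_hasLaplace {F : ℂ → ℂ} (hF : IsRationalFn F)
    (h0 : Tendsto (fun r : ℝ => F r) atTop (𝓝 0)) (n : ℕ) :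
    ∃ f : ℝ → ℝ, ContDiff ℝ n f ∧ HasLaplace (fun t => (f t : ℂ)) F := by
  obtain ⟨p, q, -, -, hlt, h⟩ := hF.exists_strictlyProper h0
  obtain ⟨g, hg, hL⟩ := exists_hasLaplace_re hlt
  exact ⟨fun t => (g t).re, Complex.reCLM.contDiff.comp (expPoly_contDiff hg n),
    hL.congr' (h.mono fun s hs => hs.symm)⟩

/-- A rational function that vanishes at infinity and is locally bounded on the closed right
half-plane is the Laplace transform of a real function whose derivatives all decay. -/
lemma IsRationalFn.exists_hasLaplace_decay {F : ℂ → ℂ} (hF : IsRationalFn F)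
    (h0 : Tendsto (fun r : ℝ => F r) atTop (𝓝 0))
    (hb : ∀ s₀ : ℂ, 0 ≤ s₀.re → ∃ C : ℝ, ∀ᶠ ε : ℝ in 𝓝[>] 0, ‖F (s₀ + ε)‖ ≤ C) :
    ∃ f : ℝ → ℝ, Continuous f ∧ HasLaplace (fun t => (f t : ℂ)) F ∧
      ∀ k, Tendsto (iteratedDeriv k f) atTop (𝓝 0) := by
  obtain ⟨p, q, hpq, hq, hlt, h⟩ := hF.exists_strictlyProper h0
  obtain ⟨g, hg, hL⟩ := exists_hasLaplace_re hlt
  refine ⟨fun t => (g t).re, Complex.continuous_re.comp (expPoly_contDiff hg 0).continuous,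
    hL.congr' (h.mono fun s hs => hs.symm), fun k => ?_⟩
  obtain ⟨g', hg', he⟩ := expPoly_iteratedDeriv_re hg k
  rw [he]
  have hS : ∀ l ∈ {l : ℂ | aeval l q = 0}, l.re < 0 := fun l hl => by
    by_contra hre
    exact aeval_ne_zero_of_bounded hpq h hq l (hb l (not_lt.1 hre)) hl
  simpa [Function.comp_def] using
    (Complex.continuous_re.tendsto 0).comp (expPoly_tendsto_zero hS hg')

/-- Real functions with the same Laplace transform that are continuous on the positive half-line
agree there. -/
lemma HasLaplace.eq_of_continuousOn {f g : ℝ → ℝ} {F : ℂ → ℂ}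
    (hf : HasLaplace (fun t => (f t : ℂ)) F) (hg : HasLaplace (fun t => (g t : ℂ)) F)
    (hfc : ContinuousOn f (Set.Ioi 0)) (hgc : ContinuousOn g (Set.Ioi 0)) :
    ∀ t, 0 < t → f t = g t := by
  intro t ht
  have h := (hf.add (hg.const_smul (-1))).congr' (G := fun _ => 0)
    (Eventually.of_forall fun s => by simp)
  have := h.eq_zero ((Complex.continuous_ofReal.comp_continuousOn hfc).add
    ((Complex.continuous_ofReal.comp_continuousOn hgc).const_smul (-1 : ℂ))) t ht
  have h2 : (f t : ℂ) - g t = 0 := by simpa [sub_eq_add_neg] using this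
  exact_mod_cast sub_eq_zero.1 h2

lemma exists_eventually_sum_le {ι α : Type*} [Fintype ι] {l : Filter α} {f : ι → α → ℝ}
    (h : ∀ i, ∃ C, ∀ᶠ x in l, f i x ≤ C) : ∃ C, ∀ᶠ x in l, ∑ i, f i x ≤ C := by
  choose C hC using h
  exact ⟨∑ i, C i, (eventually_all.2 hC).mono fun x hx => Finset.sum_le_sum fun i _ => hx i⟩

/-! ### Trajectories and consensus -/

section Solution

variable {N : ℕ} {n : ℕ} {T : ℂ → Matrix (Fin N) (Fin N) ℂ} {U : Fin N → RatFunc ℝ} {C : ℝ}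

lemma det_ne_zero_of_bound
    (hC : ∀ s : ℂ, 0 < s.re → ∀ v : EuclideanSpace ℂ (Fin N), ‖s‖ ^ n * ‖v‖ ≤
      C * ‖Matrix.toEuclideanCLM (n := Fin N) (𝕜 := ℂ) (T s) v‖) {s : ℂ} (hs : 0 < s.re) :
    (T s).det ≠ 0 := by
  intro hd
  obtain ⟨v, hv, hTv⟩ := Matrix.exists_mulVec_eq_zero_iff.2 hd
  have h := hC s hs (WithLp.toLp 2 v)
  rw [Matrix.toEuclideanCLM_toLp, hTv, WithLp.toLp_zero, norm_zero, mul_zero] at h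
  have hs0 : s ≠ 0 := fun h => by simp [h] at hs
  have hv0 : WithLp.toLp 2 v ≠ 0 := by simpa using hv
  exact (mul_pos (pow_pos (norm_pos_iff.2 hs0) n) (norm_pos_iff.2 hv0)).not_ge h

/-- Since r^n ‖X(r)‖ ≤ C‖U(r)‖ with U bounded at infinity and n ≥ 1, X(r) = O(1/r). -/
lemma tendsto_rationalSolution (hn : 1 ≤ n) (hC0 : 0 ≤ C)
    (hC : ∀ s : ℂ, 0 < s.re → ∀ v : EuclideanSpace ℂ (Fin N), ‖s‖ ^ n * ‖v‖ ≤
      C * ‖Matrix.toEuclideanCLM (n := Fin N) (𝕜 := ℂ) (T s) v‖)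
    (hU : ∀ i, IsProperStable (U i)) (i : Fin N) :
    Tendsto (fun r : ℝ => rationalSolution T U r i) atTop (𝓝 0) := by
  obtain ⟨B, hB⟩ := exists_eventually_sum_le fun i => (hU i).bounded_atTop
  refine squeeze_zero_norm' (a := fun r : ℝ => C * B * r⁻¹) ?_
    (by simpa using tendsto_inv_atTop_zero.const_mul (C * B))
  filter_upwards [hB, eventually_ge_atTop 1] with r hr hr1
  have hr0 : 0 < r := by linarith
  have h := hC r (by simpa using hr0) (WithLp.toLp 2 (rationalSolution T U r))
  rw [Matrix.toEuclideanCLM_toLp, mulVec_rationalSolution U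
    (det_ne_zero_of_bound hC (by simpa using hr0)), Complex.norm_real, Real.norm_of_nonneg hr0.le]
    at h
  have h1 : ‖rationalSolution T U r i‖ ≤ ‖WithLp.toLp 2 (rationalSolution T U r)‖ :=
    PiLp.norm_apply_le (WithLp.toLp 2 (rationalSolution T U r)) i
  have h2 : r ≤ r ^ n := le_self_pow₀ hr1 (by omega)
  rw [← div_eq_mul_inv, le_div_iff₀ hr0, mul_comm]
  calc r * ‖rationalSolution T U r i‖
      ≤ r ^ n * ‖WithLp.toLp 2 (rationalSolution T U r)‖ := by gcongr
    _ ≤ C * ‖WithLp.toLp 2 fun i => evalAt (U i) r‖ := h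
    _ ≤ C * B := by gcongr; exact (norm_toLp_le _).trans hr

/-- The disagreement bound has no factor of s, so it does not degenerate at the imaginary axis;
passing to differences of entries loses nothing, since v - Pv is constant. -/
lemma rationalSolution_sub_bounded (hC0 : 0 ≤ C)
    (hd : ∀ s : ℂ, 0 < s.re → (T s).det ≠ 0)
    (hC : ∀ s : ℂ, 0 < s.re → ∀ v : EuclideanSpace ℂ (Fin N), ‖disagreement N v‖ ≤
      C * ‖Matrix.toEuclideanCLM (n := Fin N) (𝕜 := ℂ) (T s) v‖)
    (hU : ∀ i, IsProperStable (U i)) (i j : Fin N) {s₀ : ℂ} (hs₀ : 0 ≤ s₀.re) :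
    ∃ B : ℝ, ∀ᶠ ε : ℝ in 𝓝[>] 0,
      ‖rationalSolution T U (s₀ + ε) i - rationalSolution T U (s₀ + ε) j‖ ≤ B := by
  obtain ⟨B, hB⟩ := exists_eventually_sum_le fun i => (hU i).bounded_near hs₀
  refine ⟨C * B + C * B, ?_⟩
  filter_upwards [hB, self_mem_nhdsWithin] with ε hε hε0
  have hs : 0 < (s₀ + ε).re := by
    have : (0 : ℝ) < ε := hε0
    simp only [Complex.add_re, Complex.ofReal_re]
    linarith
  set v : EuclideanSpace ℂ (Fin N) := WithLp.toLp 2 (rationalSolution T U (s₀ + ε)) with hv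
  have h := hC _ hs v
  rw [hv, Matrix.toEuclideanCLM_toLp, mulVec_rationalSolution U (hd _ hs), ← hv] at h
  have h1 : ‖disagreement N v‖ ≤ C * B :=
    h.trans (mul_le_mul_of_nonneg_left ((norm_toLp_le _).trans hε) hC0)
  have h2 := disagreement_sub_apply v i j
  change _ = rationalSolution T U (s₀ + ε) i - rationalSolution T U (s₀ + ε) j at h2
  rw [← h2]
  exact (norm_sub_le _ _).trans
    (add_le_add ((PiLp.norm_apply_le _ i).trans h1) ((PiLp.norm_apply_le _ j).trans h1))

lemma exists_isTrajectory (hd : ∀ s : ℂ, 0 < s.re → (T s).det ≠ 0)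
    (hT : ∀ i j, IsRationalFn fun s => T s i j)
    (h0 : ∀ i, Tendsto (fun r : ℝ => rationalSolution T U r i) atTop (𝓝 0)) :
    ∃ x : ℝ → Fin N → ℝ, IsTrajectory n T U x := by
  choose f hf hL using fun i => (isRationalFn_rationalSolution hT U i).exists_hasLaplace (h0 i) n
  choose σ hσ using hL
  obtain ⟨b, hb⟩ := (Set.finite_range σ).bddAbove
  -- The bound b dominates the abscissas of all components; 0 ensures that T(s) is invertible.
  refine ⟨fun t i => f i t, fun i => (hf i).contDiffOn, max b 0, fun s hs => ?_⟩
  have hsσ : ∀ i, σ i < s.re := fun i =>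
    (hb ⟨i, rfl⟩).trans_lt ((le_max_left _ _).trans_lt hs)
  refine ⟨fun i => (hσ i s (hsσ i)).1, ?_⟩
  rw [← mulVec_rationalSolution U (hd s ((le_max_right _ _).trans_lt hs))]
  congr 1
  funext i
  exact (hσ i s (hsσ i)).2

lemma IsTrajectory.hasLaplace {x : ℝ → Fin N → ℝ} (hx : IsTrajectory n T U x)
    (hd : ∀ s : ℂ, 0 < s.re → (T s).det ≠ 0) (i : Fin N) :
    HasLaplace (fun t => (x t i : ℂ)) fun s => rationalSolution T U s i := by
  obtain ⟨σ, hσ⟩ := hx.laplace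
  refine ⟨max σ 0, fun s hs => ?_⟩
  obtain ⟨h1, h2⟩ := hσ s ((le_max_left _ _).trans_lt hs)
  have hds := hd s ((le_max_right _ _).trans_lt hs)
  rw [← mulVec_rationalSolution U hds] at h2
  have hinj := Matrix.mulVec_injective_of_isUnit
    ((Matrix.isUnit_iff_isUnit_det _).2 (isUnit_iff_ne_zero.2 hds)) h2
  exact ⟨h1 i, congrFun hinj i⟩

lemma IsTrajectory.achievesConsensus {x : ℝ → Fin N → ℝ} (hx : IsTrajectory n T U x)
    (hd : ∀ s : ℂ, 0 < s.re → (T s).det ≠ 0) (hT : ∀ i j, IsRationalFn fun s => T s i j)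
    (h0 : ∀ i, Tendsto (fun r : ℝ => rationalSolution T U r i) atTop (𝓝 0))
    (hb : ∀ i j, ∀ s₀ : ℂ, 0 ≤ s₀.re → ∃ B : ℝ, ∀ᶠ ε : ℝ in 𝓝[>] 0,
      ‖rationalSolution T U (s₀ + ε) i - rationalSolution T U (s₀ + ε) j‖ ≤ B) :
    AchievesConsensus n x := by
  intro i j k hk
  obtain ⟨f, hfc, hfL, hfd⟩ := ((isRationalFn_rationalSolution hT U i).sub
    (isRationalFn_rationalSolution hT U j)).exists_hasLaplace_decay
      (by simpa using (h0 i).sub (h0 j)) (hb i j)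
  have hxL : HasLaplace (fun t => ((x t i - x t j : ℝ) : ℂ))
      fun s => rationalSolution T U s i - rationalSolution T U s j := by
    have h := (hx.hasLaplace hd i).add ((hx.hasLaplace hd j).const_smul (-1))
    convert! h using 1
    · funext t
      simp [sub_eq_add_neg]
    · funext s
      simp [sub_eq_add_neg]
  -- Here x_i - x_j is identified with f on t > 0; being an equality on an open set, it passes to
  -- iterated derivatives.
  have heq := hxL.eq_of_continuousOn hfL
    ((hx.contDiffOn i).continuousOn.sub (hx.contDiffOn j).continuousOn) hfc.continuousOn
  have habs := (hfd k).abs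
  rw [abs_zero] at habs
  refine habs.congr' ?_
  filter_upwards [eventually_gt_atTop 0] with t ht
  have hcd : ∀ i, ContDiffAt ℝ k (fun τ => x τ i) t := fun i =>
    ((hx.contDiffOn i).contDiffAt (Ioi_mem_nhds ht)).of_le (by exact_mod_cast hk.le)
  rw [← iteratedDeriv_sub (hcd i) (hcd j)]
  congr 1
  refine EventuallyEq.iteratedDeriv_eq k ?_
  filter_upwards [Ioi_mem_nhds ht] with τ hτ
  exact (heq τ hτ).symm

end Solution

end SerialConsensus

theorem mainTheorem5 {N : ℕ} (n : ℕ) (hn : 1 ≤ n)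
    (W : ℕ → Matrix (Fin N) (Fin N) ℝ)
    (hW : ∀ k, 1 ≤ k → k ≤ n → ∀ i j, 0 ≤ W k i j)
    (hsymm : ∀ k, 1 ≤ k → k ≤ n → (SerialConsensus.laplacian (W k)).IsSymm)
    (htree : ∀ k, 1 ≤ k → k ≤ n → SerialConsensus.HasConnectedSpanningTree (W k))
    (Δ : ℕ → Matrix (Fin N) (Fin N) (RatFunc ℝ))
    (hΔ : ∀ k, k ≤ n → SerialConsensus.IsRHInf (Δ k))
    (U : Fin N → RatFunc ℝ) (hU : ∀ i, SerialConsensus.IsProperStable (U i))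
    (hnorm : ∀ k, k ≤ n → SerialConsensus.hInfNorm (Δ k) < 1)
    (hnorm₀ : SerialConsensus.hInfNorm (Δ 0) + SerialConsensus.hInfNorm (Δ n) < 1) :
    (∃ x : ℝ → Fin N → ℝ, SerialConsensus.IsTrajectory n
      (SerialConsensus.perturbedSystem n (fun k => SerialConsensus.laplacian (W k)) Δ) U x) ∧
    ∀ x : ℝ → Fin N → ℝ, SerialConsensus.IsTrajectory n
      (SerialConsensus.perturbedSystem n (fun k => SerialConsensus.laplacian (W k)) Δ) U x →
      SerialConsensus.AchievesConsensus n x := by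
  obtain ⟨C, hC0, hC⟩ := SerialConsensus.perturbedSystem_bound n hn W hW hsymm htree Δ
    hnorm hnorm₀
  have hCs := fun s hs v => (hC s hs v).1
  have hd := fun s hs => SerialConsensus.det_ne_zero_of_bound (s := s) hCs hs
  have hT := SerialConsensus.isRationalFn_perturbedSystem n
    (fun k => SerialConsensus.laplacian (W k)) Δ
  have h0 := SerialConsensus.tendsto_rationalSolution hn hC0 hCs hU
  refine ⟨SerialConsensus.exists_isTrajectory hd hT h0, fun x hx =>
    hx.achievesConsensus hd hT h0 fun i j s₀ hs₀ => ?_⟩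
  exact SerialConsensus.rationalSolution_sub_bounded hC0 hd (fun s hs v => (hC s hs v).2) hU i j hs₀
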